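/- Let $n\ge 3$ and let $\Gamma\subset\mathbb R^n$ be an open convex symmetric cone with vertex at the origin (symmetric: invariant under permutations of the coordinates) such that $$\{\lambda\in\mathbb R^n:\lambda_i>0,\ 1\le i\le n\}\subset\Gamma\subset\{\lambda\in\mathbb R^n:\lambda_1+\dots+\lambda_n>0\}.$$ Let $\mu_\Gamma^+\in[0,n-1]$ be the unique number with $(-\mu_\Gamma^+,1,\dots,1)\in\partial\Gamma$, and assume $\mu_\Gamma^+>1$. Let $(M,g)$ be a smooth complete connected Riemannian manifold of dimension $n$ with distance $d_g$, let $\Omega\subset M$ be open and $p_0\in\Omega$. For a positive function $\varphi$ put $g_\varphi=\varphi^{\frac4{n-2}}g$; let $A_{g_\varphi}=\frac1{n-2}\big(\mathrm{Ric}_{g_\varphi}-\frac{R_{g_\varphi}}{2(n-1)}g_\varphi\big)$ be its Schouten tensor and $\lambda(A_{g_\varphi})$ the eigenvalues of $A_{g_\varphi}$ with respect to $g_\varphi$. Let $u:\Omega\setminus\{p_0\}\to(0,\infty)$ be upper semicontinuous and locally bounded, and assume that $u$ is a viscosity solution of $$\lambda(A_{g_u})\in\mathbb R^n\setminus\Gamma\quad\text{in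 }\Omega\setminus\{p_0\},$$ that is: whenever $x_0\in\Omega\setminus\{p_0\}$ and $\varphi$ is a $C^2$ function near $x_0$ with $\varphi(x_0)=u(x_0)$ and $\varphi\ge u$ near $x_0$, then $\lambda(A_{g_\varphi}(x_0))\in\mathbb R^n\setminus\Gamma$. If $$\lim_{x\to p_0}u(x)\,d_g(x,p_0)^{n-2}=0,$$ then $u$ is bounded in a punctured neighborhood of $p_0$. -/

import Mathlib

open Bundle
open scoped Manifold ContDiff Topology

noncomputable section

/-! ### Cones of eigenvalues -/

/-- `Γ ⊆ ℝⁿ` is an open convex symmetric cone with vertex at the origin, which contains the positive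
cone `{λ | λ_i > 0 for all i}` and is contained in the half-space `{λ | λ_1 + ... + λ_n > 0}`. -/
structure IsAdmissibleCone {n : ℕ} (Γ : Set (Fin n → ℝ)) : Prop where
  isOpen : IsOpen Γ
  convex : Convex ℝ Γ
  symmetric : ∀ (σ : Equiv.Perm (Fin n)), ∀ lam ∈ Γ, lam ∘ σ ∈ Γ
  cone : ∀ t : ℝ, 0 < t → ∀ lam ∈ Γ, t • lam ∈ Γ
  pos_subset : {lam : Fin n → ℝ | ∀ i, 0 < lam i} ⊆ Γ
  subset_trace : Γ ⊆ {lam : Fin n → ℝ | 0 < ∑ i, lam i}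

/-- The vector `(-μ, 1, ..., 1) ∈ ℝⁿ`. -/
def muVec (n : ℕ) (μ : ℝ) : Fin n → ℝ := fun i => if (i : ℕ) = 0 then -μ else 1

/-- The number `μ_Γ⁺ ∈ [0, n - 1]` with `(-μ_Γ⁺, 1, ..., 1) ∈ ∂Γ`. For an admissible cone there is
exactly one such number (`existsUnique_muVec_mem_frontier`), and `muPlus Γ` is that number
(`muPlus_spec`). -/
def muPlus {n : ℕ} (Γ : Set (Fin n → ℝ)) : ℝ :=
  sSup {μ : ℝ | μ ∈ Set.Icc (0 : ℝ) ((n : ℝ) - 1) ∧ muVec n μ ∈ frontier Γ}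

theorem muVec_sum {n : ℕ} (hn : 1 ≤ n) (μ : ℝ) : ∑ i, muVec n μ i = (n : ℝ) - 1 - μ := by
  obtain ⟨m, rfl⟩ : ∃ m, n = m + 1 := ⟨n - 1, by omega⟩
  rw [Fin.sum_univ_succ]
  simp [muVec]
  ring

theorem continuous_muVec (n : ℕ) : Continuous (muVec n) := by
  refine continuous_pi fun i => ?_
  unfold muVec
  by_cases h : (i : ℕ) = 0
  · simpa [h] using continuous_neg
  · simpa [h] using continuous_const

theorem existsUnique_muVec_mem_frontier {n : ℕ} (hn : 1 ≤ n) {Γ : Set (Fin n → ℝ)}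
    (hΓ : IsAdmissibleCone Γ) :
    ∃! μ : ℝ, μ ∈ Set.Icc (0 : ℝ) ((n : ℝ) - 1) ∧ muVec n μ ∈ frontier Γ := by
  have hneg : ∀ μ : ℝ, μ < 0 → muVec n μ ∈ Γ := by
    intro μ hμ
    refine hΓ.pos_subset fun i => ?_
    unfold muVec
    split_ifs <;> linarith
  have hlt : ∀ μ ν : ℝ, ν < μ → muVec n μ ∈ closure Γ → muVec n ν ∈ Γ := by
    intro μ ν hνμ hμ
    by_cases hν : ν < 0
    · exact hneg ν hν
    have hν0 : 0 ≤ ν := not_lt.mp hν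
    have hint : muVec n (-1) ∈ interior Γ := by
      rw [hΓ.isOpen.interior_eq]
      exact hneg _ (by norm_num)
    have hd : (0 : ℝ) < μ + 1 := by linarith
    have h1 : (0 : ℝ) ≤ (ν + 1) / (μ + 1) := by positivity
    have h2 : (0 : ℝ) < (μ - ν) / (μ + 1) := div_pos (by linarith) hd
    have h3 : (ν + 1) / (μ + 1) + (μ - ν) / (μ + 1) = 1 := by
      field_simp
      ring
    have h := hΓ.convex.combo_closure_interior_mem_interior hμ hint h1 h2 h3
    have heq : ((ν + 1) / (μ + 1)) • muVec n μ + ((μ - ν) / (μ + 1)) • muVec n (-1)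
        = muVec n ν := by
      ext i
      simp only [Pi.add_apply, Pi.smul_apply, smul_eq_mul, muVec]
      split_ifs
      · field_simp
        ring
      · rw [mul_one, mul_one, h3]
    rw [heq] at h
    exact interior_subset h
  have hle : ∀ μ : ℝ, muVec n μ ∈ closure Γ → μ ≤ (n : ℝ) - 1 := by
    intro μ hμ
    have hcl : IsClosed {lam : Fin n → ℝ | 0 ≤ ∑ i, lam i} :=
      isClosed_le continuous_const (continuous_finsetSum _ fun i _ => continuous_apply i)
    have hsub : Γ ⊆ {lam : Fin n → ℝ | 0 ≤ ∑ i, lam i} :=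
        fun lam h => show 0 ≤ ∑ i, lam i from le_of_lt (hΓ.subset_trace h)
    have h : 0 ≤ ∑ i, muVec n μ i := closure_minimal hsub hcl hμ
    rw [muVec_sum hn] at h
    linarith
  have hbdd : BddAbove {μ : ℝ | muVec n μ ∈ Γ} :=
    ⟨(n : ℝ) - 1, fun μ hμ => hle μ (subset_closure hμ)⟩
  have hne : {μ : ℝ | muVec n μ ∈ Γ}.Nonempty := ⟨-1, hneg _ (by norm_num)⟩
  have hopen : IsOpen {μ : ℝ | muVec n μ ∈ Γ} := hΓ.isOpen.preimage (continuous_muVec n)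
  have hmem : muVec n (sSup {μ : ℝ | muVec n μ ∈ Γ}) ∈ closure Γ := by
    have h := csSup_mem_closure hne hbdd
    exact (continuous_muVec n).closure_preimage_subset Γ h
  have hnot : muVec n (sSup {μ : ℝ | muVec n μ ∈ Γ}) ∉ Γ := by
    intro h
    obtain ⟨ε, hε, hb⟩ := Metric.isOpen_iff.mp hopen _ h
    have h' : sSup {μ : ℝ | muVec n μ ∈ Γ} + ε / 2 ∈ {μ : ℝ | muVec n μ ∈ Γ} := by
      apply hb
      rw [Metric.mem_ball, Real.dist_eq, add_sub_cancel_left, abs_of_pos (by linarith)]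
      linarith
    have := le_csSup hbdd h'
    linarith
  refine ⟨sSup {μ : ℝ | muVec n μ ∈ Γ}, ⟨⟨?_, hle _ hmem⟩, ?_⟩, ?_⟩
  · by_contra h
    exact hnot (hneg _ (not_le.mp h))
  · rw [hΓ.isOpen.frontier_eq]
    exact ⟨hmem, hnot⟩
  · rintro ν ⟨-, hν⟩
    rw [hΓ.isOpen.frontier_eq] at hν
    rcases lt_trichotomy ν (sSup {μ : ℝ | muVec n μ ∈ Γ}) with h | h | h
    · exact absurd (hlt _ _ h hmem) hν.2
    · exact h
    · exact absurd (hlt _ _ h hν.1) hnot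

theorem muPlus_spec {n : ℕ} (hn : 1 ≤ n) {Γ : Set (Fin n → ℝ)} (hΓ : IsAdmissibleCone Γ) :
    muPlus Γ ∈ Set.Icc (0 : ℝ) ((n : ℝ) - 1) ∧ muVec n (muPlus Γ) ∈ frontier Γ := by
  obtain ⟨μ, hμ, huniq⟩ := existsUnique_muVec_mem_frontier hn hΓ
  have h : {ν : ℝ | ν ∈ Set.Icc (0 : ℝ) ((n : ℝ) - 1) ∧ muVec n ν ∈ frontier Γ} = {μ} := by
    ext ν
    exact ⟨fun h => huniq ν h, fun h => by rw [Set.mem_singleton_iff.mp h]; exact hμ⟩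
  have h' : muPlus Γ = μ := by
    unfold muPlus
    rw [h, csSup_singleton]
  rw [h']
  exact hμ

/-! ### Curvature of a metric in coordinates

A (twice differentiable) metric on an open set of `ℝⁿ` is given by its matrix of coefficients
`G y = (g_ij(y))`. -/

/-- The partial derivative `∂_i f (y)`. -/
def partialD {n : ℕ} (i : Fin n) (f : EuclideanSpace ℝ (Fin n) → ℝ)
    (y : EuclideanSpace ℝ (Fin n)) : ℝ :=
  fderiv ℝ f y (EuclideanSpace.single i 1)

/-- The Christoffel symbol
`Γ^k_ij = ½ g^{kl} (∂_i g_jl + ∂_j g_il - ∂_l g_ij)` of the metric `G`. -/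
def christoffel {n : ℕ} (G : EuclideanSpace ℝ (Fin n) → Matrix (Fin n) (Fin n) ℝ)
    (k i j : Fin n) (y : EuclideanSpace ℝ (Fin n)) : ℝ :=
  (1 / 2) * ∑ l, (G y)⁻¹ k l *
    (partialD i (fun z => G z j l) y + partialD j (fun z => G z i l) y
      - partialD l (fun z => G z i j) y)

/-- The Ricci tensor
`R_ij = ∂_k Γ^k_ij - ∂_j Γ^k_ik + Γ^k_kl Γ^l_ij - Γ^k_jl Γ^l_ik` of the metric `G`
(positive on round spheres). -/
def ricciTensor {n : ℕ} (G : EuclideanSpace ℝ (Fin n) → Matrix (Fin n) (Fin n) ℝ)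
    (y : EuclideanSpace ℝ (Fin n)) : Matrix (Fin n) (Fin n) ℝ :=
  Matrix.of fun i j =>
    ∑ k, (partialD k (christoffel G k i j) y - partialD j (christoffel G k i k) y)
      + ∑ k, ∑ l, (christoffel G k k l y * christoffel G l i j y
          - christoffel G k j l y * christoffel G l i k y)

/-- The scalar curvature `R = g^{ij} R_ij` of the metric `G`. -/
def scalarCurvature {n : ℕ} (G : EuclideanSpace ℝ (Fin n) → Matrix (Fin n) (Fin n) ℝ)
    (y : EuclideanSpace ℝ (Fin n)) : ℝ :=
  ∑ i, ∑ j, (G y)⁻¹ i j * ricciTensor G y i j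

/-- The Schouten tensor `A = (1 / (n - 2)) (Ric - R / (2 (n - 1)) g)` of the metric `G`. -/
def schoutenTensor {n : ℕ} (G : EuclideanSpace ℝ (Fin n) → Matrix (Fin n) (Fin n) ℝ)
    (y : EuclideanSpace ℝ (Fin n)) : Matrix (Fin n) (Fin n) ℝ :=
  (1 / ((n : ℝ) - 2)) •
    (ricciTensor G y - (scalarCurvature G y / (2 * ((n : ℝ) - 1))) • G y)

/-- `lam` is the tuple of the eigenvalues, in some order and with multiplicity, of the symmetric
bilinear form `A` with respect to the inner product `G`: some `G`-orthonormal basis (the columns of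
`P`) diagonalizes `A` with diagonal entries `lam`. -/
def IsEigenvalueTuple {n : ℕ} (A G : Matrix (Fin n) (Fin n) ℝ) (lam : Fin n → ℝ) : Prop :=
  ∃ P : Matrix (Fin n) (Fin n) ℝ,
    P.transpose * G * P = 1 ∧ P.transpose * A * P = Matrix.diagonal lam

/-! ### The Riemannian manifold -/

section Manifold

attribute [local instance 2000] chartedSpaceSelf

variable {n : ℕ} {M : Type*} [MetricSpace M] [ChartedSpace (EuclideanSpace ℝ (Fin n)) M]
  [RiemannianBundle (fun x : M => TangentSpace (𝓡 n) x)]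

/-- The coefficients `g_ij = g(∂_i, ∂_j)` of the Riemannian metric in the chart `e`, as functions
on the target of `e`. -/
def metricInChart (e : OpenPartialHomeomorph M (EuclideanSpace ℝ (Fin n)))
    (y : EuclideanSpace ℝ (Fin n)) : Matrix (Fin n) (Fin n) ℝ :=
  Matrix.of fun i j =>
    inner ℝ
      (mfderiv (𝓡 n) (𝓡 n) e.symm y
        (EuclideanSpace.single i (1 : ℝ) : EuclideanSpace ℝ (Fin n)))
      (mfderiv (𝓡 n) (𝓡 n) e.symm y
        (EuclideanSpace.single j (1 : ℝ) : EuclideanSpace ℝ (Fin n)))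

/-- The coefficients in the chart `e` of the conformal metric `g_φ = φ^{4/(n-2)} g`. -/
def conformalMetricInChart (φ : M → ℝ) (e : OpenPartialHomeomorph M (EuclideanSpace ℝ (Fin n)))
    (y : EuclideanSpace ℝ (Fin n)) : Matrix (Fin n) (Fin n) ℝ :=
  (φ (e.symm y)) ^ (4 / ((n : ℝ) - 2)) • metricInChart e y

/-- `lam = λ(A_{g_φ}(x))`: the tuple `lam` consists of the eigenvalues, with respect to
`g_φ = φ^{4/(n-2)} g`, of the Schouten tensor of `g_φ` at the point `x`. The tensors are
computed in smooth charts around `x`; the eigenvalues do not depend on the chart. -/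
def IsSchoutenSpectrumAt (φ : M → ℝ) (x : M) (lam : Fin n → ℝ) : Prop :=
  ∀ e ∈ IsManifold.maximalAtlas (𝓡 n) ∞ M, x ∈ e.source →
    IsEigenvalueTuple (schoutenTensor (conformalMetricInChart φ e) (e x))
      (conformalMetricInChart φ e (e x)) lam

/-- `u` satisfies `λ(A_{g_u}) ∈ ℝⁿ \ Γ` in `D` in the viscosity sense: whenever a `C²` function `φ`
touches `u` from above at a point `x` of `D`, one has `λ(A_{g_φ}(x)) ∈ ℝⁿ \ Γ`. -/
def IsViscositySolution (Γ : Set (Fin n → ℝ)) (u : M → ℝ) (D : Set M) : Prop :=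
  ∀ x ∈ D, ∀ φ : M → ℝ, ContMDiffAt (𝓡 n) 𝓘(ℝ, ℝ) 2 φ x → φ x = u x →
    (∀ᶠ y in 𝓝 x, u y ≤ φ y) →
    ∃ lam : Fin n → ℝ, IsSchoutenSpectrumAt φ x lam ∧ lam ∈ Γᶜ

end Manifold

end

/-! The proof compares `u` with explicit conformal factors Φ_c, 0 < c ≤ 1, which blow up at p₀ like
d^(2-n), a rate that `u` does not reach, and whose singularity disappears as c → 0. In a chart at p₀
let ρ be the squared distance to the centre in the metric frozen there, r = √ρ, and Φ_c =
exp((n-2)/2 · F) with F = (1/κ) log(1 + c ρ^(-κ)) - r.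

Put a = -2ρ F'(ρ) and t = a - a²/2. For a flat background the Schouten tensor of e^(2F) g has,
relative to g, the tangential eigenvalue t/ρ and the radial one (-t + 2ρ a'(ρ))/ρ. Without the term
-r one has 2ρ a' = -2κt exactly, so the eigenvalues are proportional to (-(1+2κ), 1, ..., 1). This
tuple lies in Γ for small κ because μ_Γ⁺ > 1. The curved background adds errors of size (ρ + a r)/ρ.
The term -r keeps t large enough to absorb them when c ρ^(-κ) is small, and κ ≤ 1/4 does so when it
is large, uniformly in c (`barrier_scalar`). Hence all the eigenvalues lie in Γ on one punctured
ball independent of c (`exists_barrier_mem_cone`).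

A multiple of Φ_c therefore cannot touch `u` from above (`not_eventually_le_barrierFun`). Since `u`
is below A Φ_c on the boundary sphere, with A independent of c, and near the centre by the decay
hypothesis, `le_mul_of_forall_not_touching` gives `u` ≤ A Φ_c on the whole punctured ball. Choosing
c = min(1, ρ^κ) at each point bounds the right side. -/

noncomputable section

/-! ### Pointwise algebra of the Ricci tensor under a conformal change -/

/-- The difference between the Christoffel symbols of `e^{2F} g` and those of `g`; here `F` is
the differential and `Fu` the gradient of the conformal exponent. -/
def conformalDiff {n : ℕ} (g : Matrix (Fin n) (Fin n) ℝ) (F Fu : Fin n → ℝ) (k i j : Fin n) : ℝ :=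
  (if k = i then F j else 0) + (if k = j then F i else 0) - g i j * Fu k

theorem sum_conformalDiff {n : ℕ} {g : Matrix (Fin n) (Fin n) ℝ} {F Fu : Fin n → ℝ}
    (hF : ∀ i, ∑ k, g i k * Fu k = F i) (i : Fin n) :
    ∑ k, conformalDiff g F Fu k i k = n * F i := by
  simp only [conformalDiff, Finset.sum_sub_distrib, Finset.sum_add_distrib, hF]
  simp

theorem conformalDiff_symm {n : ℕ} {g : Matrix (Fin n) (Fin n) ℝ} {F Fu : Fin n → ℝ}
    (hg : ∀ i j, g i j = g j i) (k i j : Fin n) :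
    conformalDiff g F Fu k i j = conformalDiff g F Fu k j i := by
  simp only [conformalDiff, hg i j]
  ring

theorem sum_mul_conformalDiff {n : ℕ} {g : Matrix (Fin n) (Fin n) ℝ} {F Fu : Fin n → ℝ}
    (v : Fin n → ℝ) (i j : Fin n) :
    ∑ k, v k * conformalDiff g F Fu k i j = v i * F j + v j * F i - g i j * ∑ k, v k * Fu k := by
  simp only [conformalDiff, mul_sub, mul_add, Finset.sum_sub_distrib, Finset.sum_add_distrib,
    mul_ite, mul_zero, Finset.sum_ite_eq', Finset.mem_univ, if_true, Finset.mul_sum]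
  congr 1
  refine Finset.sum_congr rfl fun k _ => by ring

theorem sum_sum_conformalDiff_mul {n : ℕ} {g : Matrix (Fin n) (Fin n) ℝ} {F Fu : Fin n → ℝ}
    (T : Fin n → Fin n → ℝ) (j : Fin n) :
    ∑ k, ∑ l, conformalDiff g F Fu k j l * T l k
      = ∑ l, F l * T l j + F j * ∑ k, T k k - ∑ k, Fu k * ∑ l, g j l * T l k := by
  simp only [conformalDiff, sub_mul, add_mul, Finset.sum_sub_distrib, Finset.sum_add_distrib,
    ite_mul, zero_mul, Finset.mul_sum]
  congr 1
  · congr 1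
    · rw [Finset.sum_comm]
      simp
    · simp
  · refine Finset.sum_congr rfl fun k _ => Finset.sum_congr rfl fun l _ => by ring

theorem ricci_conformal_quadratic {n : ℕ} {g : Matrix (Fin n) (Fin n) ℝ} {F Fu : Fin n → ℝ}
    (hg : ∀ i j, g i j = g j i) (hF : ∀ i, ∑ k, g i k * Fu k = F i) (i j : Fin n) :
    ∑ k, ∑ l, (conformalDiff g F Fu k k l * conformalDiff g F Fu l i j
        - conformalDiff g F Fu k j l * conformalDiff g F Fu l i k)
      = ((n : ℝ) - 2) * (F i * F j - g i j * ∑ k, F k * Fu k) := by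
  have h1 : ∑ k, ∑ l, conformalDiff g F Fu k k l * conformalDiff g F Fu l i j
      = n * (2 * F i * F j - g i j * ∑ k, F k * Fu k) := by
    rw [Finset.sum_comm]
    have : ∀ l, ∑ k, conformalDiff g F Fu k k l * conformalDiff g F Fu l i j
        = n * (F l * conformalDiff g F Fu l i j) := by
      intro l
      rw [← Finset.sum_mul, ← mul_assoc, ← sum_conformalDiff hF]
      congr 1
      exact Finset.sum_congr rfl fun k _ => conformalDiff_symm hg _ _ _
    simp only [this]
    rw [← Finset.mul_sum, sum_mul_conformalDiff]
    ring
  have h3 : ∀ k, ∑ l, g j l * conformalDiff g F Fu l i k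
      = g j i * F k + g j k * F i - g i k * F j := by
    intro k
    rw [sum_mul_conformalDiff, hF]
  have h2 : ∑ k, ∑ l, conformalDiff g F Fu k j l * conformalDiff g F Fu l i k
      = (n + 2) * (F i * F j) - 2 * (g i j * ∑ k, F k * Fu k) := by
    rw [sum_sum_conformalDiff_mul (fun l k => conformalDiff g F Fu l i k),
      sum_mul_conformalDiff, sum_conformalDiff hF]
    simp only [h3]
    have : ∑ k, Fu k * (g j i * F k + g j k * F i - g i k * F j)
        = g j i * ∑ k, F k * Fu k + F i * ∑ k, g j k * Fu k - F j * ∑ k, g i k * Fu k := by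
      simp only [Finset.mul_sum, ← Finset.sum_add_distrib, ← Finset.sum_sub_distrib]
      exact Finset.sum_congr rfl fun k _ => by ring
    rw [this, hF, hF, hg j i]
    ring
  simp only [Finset.sum_sub_distrib, h1, h2]
  ring

/-- These are the terms of Γ·Γ linear in the difference tensor. By `hdg`, which is metric
compatibility, the contractions that lower an index combine into the derivative of g; that last term
cancels in `ricci_conformal_algebra`. -/
theorem ricci_conformal_cross {n : ℕ} {g : Matrix (Fin n) (Fin n) ℝ} {F Fu : Fin n → ℝ}
    {C : Fin n → Fin n → Fin n → ℝ} {dg : Fin n → Fin n → Fin n → ℝ}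
    (hg : ∀ i j, g i j = g j i) (hF : ∀ i, ∑ k, g i k * Fu k = F i)
    (hC : ∀ k i j, C k i j = C k j i)
    (hdg : ∀ k i j, dg k i j = ∑ l, (g i l * C l k j + g j l * C l k i)) (i j : Fin n) :
    ∑ k, ∑ l, ((conformalDiff g F Fu k k l * C l i j + C k k l * conformalDiff g F Fu l i j)
        - (conformalDiff g F Fu k j l * C l i k + C k j l * conformalDiff g F Fu l i k))
      = ((n : ℝ) - 2) * ∑ l, C l i j * F l - g i j * ∑ l, (∑ k, C k k l) * Fu l
        + ∑ k, dg k i j * Fu k := by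
  have h1 : ∑ k, ∑ l, conformalDiff g F Fu k k l * C l i j = n * ∑ l, C l i j * F l := by
    rw [Finset.sum_comm, Finset.mul_sum]
    refine Finset.sum_congr rfl fun l _ => ?_
    rw [← Finset.sum_mul]
    have := sum_conformalDiff hF l
    rw [show ∑ k, conformalDiff g F Fu k k l = n * F l by
      rw [← this]; exact Finset.sum_congr rfl fun k _ => conformalDiff_symm hg _ _ _]
    ring
  have h2 : ∑ k, ∑ l, C k k l * conformalDiff g F Fu l i j
      = (∑ k, C k k i) * F j + (∑ k, C k k j) * F i - g i j * ∑ l, (∑ k, C k k l) * Fu l := by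
    rw [Finset.sum_comm]
    simp only [← Finset.sum_mul]
    rw [sum_mul_conformalDiff (fun l => ∑ k, C k k l)]
  have h3 : ∑ k, ∑ l, conformalDiff g F Fu k j l * C l i k
      = ∑ l, F l * C l i j + F j * ∑ k, C k i k - ∑ k, Fu k * ∑ l, g j l * C l i k :=
    sum_sum_conformalDiff_mul (fun l k => C l i k) j
  have h4 : ∑ k, ∑ l, C k j l * conformalDiff g F Fu l i k
      = ∑ l, F l * C l j i + F i * ∑ k, C k j k - ∑ k, Fu k * ∑ l, g i l * C l j k := by
    rw [← sum_sum_conformalDiff_mul (fun l k => C l j k) i, Finset.sum_comm]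
    exact Finset.sum_congr rfl fun k _ => Finset.sum_congr rfl fun l _ => by ring
  have h5 : ∑ k, dg k i j * Fu k
      = ∑ k, Fu k * ∑ l, g j l * C l i k + ∑ k, Fu k * ∑ l, g i l * C l j k := by
    rw [← Finset.sum_add_distrib]
    refine Finset.sum_congr rfl fun k _ => ?_
    rw [hdg, ← mul_add, ← Finset.sum_add_distrib, mul_comm]
    congr 1
    refine Finset.sum_congr rfl fun l _ => ?_
    rw [hC l k j, hC l k i]
    ring
  have h6 : ∑ l, F l * C l i j = ∑ l, C l i j * F l :=
    Finset.sum_congr rfl fun l _ => mul_comm _ _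
  have h7 : ∑ l, F l * C l j i = ∑ l, C l i j * F l :=
    Finset.sum_congr rfl fun l _ => by rw [hC]; ring
  have h8 : ∀ i, ∑ k, C k i k = ∑ k, C k k i := fun i =>
    Finset.sum_congr rfl fun l _ => hC _ _ _
  simp only [Finset.sum_sub_distrib, Finset.sum_add_distrib, h1, h2, h3, h4, h5, h6, h7, h8]
  ring

/-- Derivatives are independent symbols here: `H` is the matrix of second derivatives of the
exponent, and `hdF` is the differentiated relation between differential and gradient. The products
then split into background, cross and quadratic parts. -/
theorem ricci_conformal_algebra {n : ℕ} {g H : Matrix (Fin n) (Fin n) ℝ} {F Fu : Fin n → ℝ}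
    {C : Fin n → Fin n → Fin n → ℝ} {dg : Fin n → Fin n → Fin n → ℝ}
    {dFu : Fin n → Fin n → ℝ} {dC : Fin n → Fin n → Fin n → Fin n → ℝ}
    (hg : ∀ i j, g i j = g j i) (hF : ∀ i, ∑ k, g i k * Fu k = F i)
    (hH : ∀ i j, H i j = H j i)
    (hdF : ∀ i j, ∑ k, (dg j i k * Fu k + g i k * dFu k j) = H i j)
    (hC : ∀ k i j, C k i j = C k j i)
    (hdg : ∀ k i j, dg k i j = ∑ l, (g i l * C l k j + g j l * C l k i)) (i j : Fin n) :
    ∑ k, ((dC k i j k + ((if k = i then H j k else 0) + (if k = j then H i k else 0)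
            - (dg k i j * Fu k + g i j * dFu k k)))
          - (dC k i k j + ((if k = i then H k j else 0) + H i j
            - (dg j i k * Fu k + g i k * dFu k j))))
      + ∑ k, ∑ l, ((C k k l + conformalDiff g F Fu k k l) * (C l i j + conformalDiff g F Fu l i j)
          - (C k j l + conformalDiff g F Fu k j l) * (C l i k + conformalDiff g F Fu l i k))
      = (∑ k, (dC k i j k - dC k i k j) + ∑ k, ∑ l, (C k k l * C l i j - C k j l * C l i k))
        - ((n : ℝ) - 2) * (H i j - ∑ l, C l i j * F l - F i * F j)
        - (∑ k, dFu k k + ∑ l, (∑ k, C k k l) * Fu l + ((n : ℝ) - 2) * ∑ k, F k * Fu k) * g i j := by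
  have h1 := ricci_conformal_cross hg hF hC hdg i j
  have h2 := ricci_conformal_quadratic hg hF i j
  have h3 : ∑ k, ∑ l, ((C k k l + conformalDiff g F Fu k k l)
        * (C l i j + conformalDiff g F Fu l i j)
          - (C k j l + conformalDiff g F Fu k j l) * (C l i k + conformalDiff g F Fu l i k))
      = ∑ k, ∑ l, (C k k l * C l i j - C k j l * C l i k)
        + ∑ k, ∑ l, ((conformalDiff g F Fu k k l * C l i j + C k k l * conformalDiff g F Fu l i j)
        - (conformalDiff g F Fu k j l * C l i k + C k j l * conformalDiff g F Fu l i k))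
        + ∑ k, ∑ l, (conformalDiff g F Fu k k l * conformalDiff g F Fu l i j
        - conformalDiff g F Fu k j l * conformalDiff g F Fu l i k) := by
    simp only [← Finset.sum_add_distrib]
    exact Finset.sum_congr rfl fun k _ => Finset.sum_congr rfl fun l _ => by ring
  have h4 : ∑ k, ((dC k i j k + ((if k = i then H j k else 0) + (if k = j then H i k else 0)
            - (dg k i j * Fu k + g i j * dFu k k)))
          - (dC k i k j + ((if k = i then H k j else 0) + H i j
            - (dg j i k * Fu k + g i k * dFu k j))))
      = ∑ k, (dC k i j k - dC k i k j) - ((n : ℝ) - 2) * H i j - ∑ k, dg k i j * Fu k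
        - g i j * ∑ k, dFu k k := by
    have := hdF i j
    simp only [Finset.sum_add_distrib] at this
    simp only [Finset.sum_sub_distrib, Finset.sum_add_distrib, this, ← Finset.mul_sum]
    simp [hH j i]
    linarith
  rw [h3, h1, h2, h4]
  ring

/-! ### Rules for coordinate partial derivatives -/

section PartialDerivatives

variable {n : ℕ} {U : Set (EuclideanSpace ℝ (Fin n))} {y : EuclideanSpace ℝ (Fin n)}
  {f g : EuclideanSpace ℝ (Fin n) → ℝ}

theorem partialD_congr (hU : IsOpen U) (h : Set.EqOn f g U) (hy : y ∈ U) (i : Fin n) :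
    partialD i f y = partialD i g y := by
  unfold partialD
  rw [Filter.EventuallyEq.fderiv_eq (h.eventuallyEq_of_mem (hU.mem_nhds hy))]

theorem partialD_add (hf : DifferentiableAt ℝ f y) (hg : DifferentiableAt ℝ g y) (i : Fin n) :
    partialD i (fun z => f z + g z) y = partialD i f y + partialD i g y := by
  simp only [partialD, fderiv_fun_add hf hg, add_apply]

theorem partialD_sub (hf : DifferentiableAt ℝ f y) (hg : DifferentiableAt ℝ g y) (i : Fin n) :
    partialD i (fun z => f z - g z) y = partialD i f y - partialD i g y := by
  simp only [partialD, fderiv_fun_sub hf hg, sub_apply]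

theorem partialD_mul (hf : DifferentiableAt ℝ f y) (hg : DifferentiableAt ℝ g y) (i : Fin n) :
    partialD i (fun z => f z * g z) y = partialD i f y * g y + f y * partialD i g y := by
  simp only [partialD, fderiv_fun_mul hf hg, add_apply,
    smul_apply, smul_eq_mul]
  ring

theorem partialD_const (c : ℝ) (i : Fin n) : partialD i (fun _ => c) y = 0 := by
  simp [partialD]

theorem partialD_sum {ι : Type*} {s : Finset ι} {f : ι → EuclideanSpace ℝ (Fin n) → ℝ}
    (hf : ∀ k ∈ s, DifferentiableAt ℝ (f k) y) (i : Fin n) :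
    partialD i (fun z => ∑ k ∈ s, f k z) y = ∑ k ∈ s, partialD i (f k) y := by
  simp only [partialD, fderiv_fun_sum hf, sum_apply]

theorem partialD_comp {h : ℝ → ℝ} {h' : ℝ} (hh : HasDerivAt h h' (f y))
    (hf : DifferentiableAt ℝ f y) (i : Fin n) :
    partialD i (fun z => h (f z)) y = h' * partialD i f y := by
  have := (hh.comp_hasFDerivAt y hf.hasFDerivAt).fderiv
  simp only [partialD]
  rw [show (fun z => h (f z)) = h ∘ f from rfl, this]
  simp

theorem partialD_ite (p : Prop) [Decidable p] (i : Fin n) :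
    partialD i (fun z => if p then f z else 0) y = if p then partialD i f y else 0 := by
  split_ifs
  · rfl
  · exact partialD_const 0 i

theorem ContDiffOn.differentiableAt_of_isOpen (hf : ContDiffOn ℝ ∞ f U) (hU : IsOpen U)
    (hy : y ∈ U) : DifferentiableAt ℝ f y :=
  (hf.contDiffAt (hU.mem_nhds hy)).differentiableAt (by simp)

theorem ContDiffOn.partialD (hf : ContDiffOn ℝ ∞ f U) (hU : IsOpen U) (i : Fin n) :
    ContDiffOn ℝ ∞ (partialD i f) U := by
  have h := (contDiffOn_infty_iff_fderiv_of_isOpen hU).1 hf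
  exact h.2.clm_apply contDiffOn_const

theorem partialD_comm (hf : ContDiffOn ℝ ∞ f U) (hU : IsOpen U) (hy : y ∈ U) (i j : Fin n) :
    partialD i (partialD j f) y = partialD j (partialD i f) y := by
  have h : ContDiffAt ℝ ∞ f y := hf.contDiffAt (hU.mem_nhds hy)
  have hs : IsSymmSndFDerivAt ℝ f y :=
    h.isSymmSndFDerivAt (by simpa using ENat.LEInfty.out)
  have hd : DifferentiableAt ℝ (fderiv ℝ f) y :=
    (h.fderiv_right (m := ∞) (by simp)).differentiableAt (by simp)
  have key : ∀ a b : Fin n, partialD a (partialD b f) y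
      = fderiv ℝ (fderiv ℝ f) y (EuclideanSpace.single a 1) (EuclideanSpace.single b 1) := by
    intro a b
    have : (partialD b f) = fun z => fderiv ℝ f z (EuclideanSpace.single b 1) := rfl
    rw [this]
    change fderiv ℝ (fun z => fderiv ℝ f z (EuclideanSpace.single b 1)) y _ = _
    rw [fderiv_clm_apply hd (differentiableAt_const _)]
    simp
  rw [key, key]
  exact hs _ _

end PartialDerivatives

/-! ### Smooth metrics and their Levi-Civita connection -/

section Smoothness

variable {n : ℕ} {U : Set (EuclideanSpace ℝ (Fin n))}
  {G : EuclideanSpace ℝ (Fin n) → Matrix (Fin n) (Fin n) ℝ}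

/-- `G` is a smooth field of symmetric nondegenerate matrices on `U`. -/
structure IsSmoothMetricOn (G : EuclideanSpace ℝ (Fin n) → Matrix (Fin n) (Fin n) ℝ)
    (U : Set (EuclideanSpace ℝ (Fin n))) : Prop where
  isOpen : IsOpen U
  contDiffOn : ∀ i j, ContDiffOn ℝ ∞ (fun z => G z i j) U
  symm : ∀ z ∈ U, ∀ i j, G z i j = G z j i
  det_ne_zero : ∀ z ∈ U, (G z).det ≠ 0

theorem contDiffOn_det {A : EuclideanSpace ℝ (Fin n) → Matrix (Fin n) (Fin n) ℝ}
    (hA : ∀ i j, ContDiffOn ℝ ∞ (fun z => A z i j) U) :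
    ContDiffOn ℝ ∞ (fun z => (A z).det) U := by
  simp only [Matrix.det_apply']
  exact ContDiffOn.sum fun σ _ => contDiffOn_const.mul (contDiffOn_prod fun i _ => hA _ _)

namespace IsSmoothMetricOn

theorem mono {V : Set (EuclideanSpace ℝ (Fin n))} (h : IsSmoothMetricOn G U) (hV : IsOpen V)
    (hVU : V ⊆ U) : IsSmoothMetricOn G V :=
  ⟨hV, fun i j => (h.contDiffOn i j).mono hVU, fun z hz => h.symm z (hVU hz),
    fun z hz => h.det_ne_zero z (hVU hz)⟩

theorem contDiffOn_inv (h : IsSmoothMetricOn G U) (i j : Fin n) :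
    ContDiffOn ℝ ∞ (fun z => (G z)⁻¹ i j) U := by
  -- Cramer's rule: each entry of the inverse is a quotient of determinants, which are polynomial in
  -- the entries of `G`.
  have : ∀ z, (G z)⁻¹ i j = ((G z).det)⁻¹ * ((G z).updateRow j (Pi.single i 1)).det := by
    intro z
    rw [Matrix.inv_def, Matrix.smul_apply, Matrix.adjugate_apply, Ring.inverse_eq_inv',
      smul_eq_mul]
  simp only [this]
  refine ((contDiffOn_det h.contDiffOn).inv h.det_ne_zero).mul (contDiffOn_det fun a b => ?_)
  by_cases ha : a = j
  · subst ha
    simp only [Matrix.updateRow_self]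
    exact contDiffOn_const
  · simp only [Matrix.updateRow_ne ha]
    exact h.contDiffOn a b

theorem contDiffOn_christoffel (h : IsSmoothMetricOn G U) (k i j : Fin n) :
    ContDiffOn ℝ ∞ (christoffel G k i j) U :=
  contDiffOn_const.mul (ContDiffOn.sum fun l _ => (h.contDiffOn_inv k l).mul
    ((((h.contDiffOn j l).partialD h.isOpen i).add ((h.contDiffOn i l).partialD h.isOpen j)).sub
      ((h.contDiffOn i j).partialD h.isOpen l)))

theorem contDiffOn_ricciTensor (h : IsSmoothMetricOn G U) (i j : Fin n) :
    ContDiffOn ℝ ∞ (fun z => ricciTensor G z i j) U :=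
  (ContDiffOn.sum fun k _ => ((h.contDiffOn_christoffel k i j).partialD h.isOpen k).sub
    ((h.contDiffOn_christoffel k i k).partialD h.isOpen j)).add
    (ContDiffOn.sum fun k _ => ContDiffOn.sum fun l _ =>
      ((h.contDiffOn_christoffel k k l).mul (h.contDiffOn_christoffel l i j)).sub
        ((h.contDiffOn_christoffel k j l).mul (h.contDiffOn_christoffel l i k)))

theorem contDiffOn_scalarCurvature (h : IsSmoothMetricOn G U) :
    ContDiffOn ℝ ∞ (scalarCurvature G) U :=
  ContDiffOn.sum fun i _ => ContDiffOn.sum fun j _ =>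
    (h.contDiffOn_inv i j).mul (h.contDiffOn_ricciTensor i j)

theorem contDiffOn_schoutenTensor (h : IsSmoothMetricOn G U) (i j : Fin n) :
    ContDiffOn ℝ ∞ (fun z => schoutenTensor G z i j) U := by
  simp only [schoutenTensor, Matrix.smul_apply, Matrix.sub_apply, smul_eq_mul]
  exact contDiffOn_const.mul ((h.contDiffOn_ricciTensor i j).sub
    ((h.contDiffOn_scalarCurvature.div_const _).mul (h.contDiffOn i j)))

theorem mul_inv (h : IsSmoothMetricOn G U) {y : EuclideanSpace ℝ (Fin n)} (hy : y ∈ U) :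
    G y * (G y)⁻¹ = 1 :=
  Matrix.mul_nonsing_inv _ (isUnit_iff_ne_zero.2 (h.det_ne_zero y hy))

theorem inv_mul (h : IsSmoothMetricOn G U) {y : EuclideanSpace ℝ (Fin n)} (hy : y ∈ U) :
    (G y)⁻¹ * G y = 1 :=
  Matrix.nonsing_inv_mul _ (isUnit_iff_ne_zero.2 (h.det_ne_zero y hy))

theorem inv_symm (h : IsSmoothMetricOn G U) {y : EuclideanSpace ℝ (Fin n)} (hy : y ∈ U)
    (i j : Fin n) : (G y)⁻¹ i j = (G y)⁻¹ j i := by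
  have hG : (G y).transpose = G y := Matrix.ext fun a b => h.symm y hy b a
  have := Matrix.transpose_nonsing_inv (G y)
  rw [hG] at this
  exact congrFun (congrFun this j) i

theorem christoffel_symm (h : IsSmoothMetricOn G U) {y : EuclideanSpace ℝ (Fin n)} (hy : y ∈ U)
    (k i j : Fin n) : christoffel G k i j y = christoffel G k j i y := by
  unfold christoffel
  congr 1
  refine Finset.sum_congr rfl fun l _ => ?_
  rw [partialD_congr h.isOpen (fun z hz => h.symm z hz i j) hy l]
  ring

theorem sum_mul_sum_inv (h : IsSmoothMetricOn G U) {y : EuclideanSpace ℝ (Fin n)} (hy : y ∈ U)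
    (v : Fin n → ℝ) (i : Fin n) : ∑ k, G y i k * ∑ l, (G y)⁻¹ k l * v l = v i := by
  have : (G y).mulVec ((G y)⁻¹.mulVec v) = v := by
    rw [Matrix.mulVec_mulVec, h.mul_inv hy, Matrix.one_mulVec]
  exact congrFun this i

/-- The Levi-Civita connection is compatible with the metric. -/
theorem partialD_eq_christoffel (h : IsSmoothMetricOn G U) {y : EuclideanSpace ℝ (Fin n)}
    (hy : y ∈ U) (k i j : Fin n) :
    partialD k (fun z => G z i j) y
      = ∑ l, (G y i l * christoffel G l k j y + G y j l * christoffel G l k i y) := by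
  -- Koszul's formula for the symbols with lowered index; adding two instances leaves a single
  -- derivative.
  have key : ∀ a b c : Fin n, ∑ l, G y a l * christoffel G l b c y
      = (1 / 2) * (partialD b (fun z => G z c a) y + partialD c (fun z => G z b a) y
        - partialD a (fun z => G z b c) y) := by
    intro a b c
    have := h.sum_mul_sum_inv hy (fun l => partialD b (fun z => G z c l) y
      + partialD c (fun z => G z b l) y - partialD l (fun z => G z b c) y) a
    rw [← this, Finset.mul_sum]
    refine Finset.sum_congr rfl fun l _ => ?_
    unfold christoffel
    ring
  have hs : ∀ a b c, partialD a (fun z => G z b c) y = partialD a (fun z => G z c b) y :=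
    fun a b c => partialD_congr h.isOpen (fun z hz => h.symm z hz b c) hy a
  rw [Finset.sum_add_distrib, key, key, hs k j i]
  ring

end IsSmoothMetricOn

end Smoothness

/-! ### Ricci and Schouten tensors of a conformal metric -/

section ConformalChange

variable {n : ℕ} {U : Set (EuclideanSpace ℝ (Fin n))} {y : EuclideanSpace ℝ (Fin n)}
  {G G' : EuclideanSpace ℝ (Fin n) → Matrix (Fin n) (Fin n) ℝ}
  {F : EuclideanSpace ℝ (Fin n) → ℝ}

/-- The components `F^k = g^{kl} ∂_l F` of the gradient of `F`. -/
def gradD (G : EuclideanSpace ℝ (Fin n) → Matrix (Fin n) (Fin n) ℝ)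
    (F : EuclideanSpace ℝ (Fin n) → ℝ) (k : Fin n) (y : EuclideanSpace ℝ (Fin n)) : ℝ :=
  ∑ l, (G y)⁻¹ k l * partialD l F y

namespace IsSmoothMetricOn

theorem contDiffOn_gradD (h : IsSmoothMetricOn G U) (hF : ContDiffOn ℝ ∞ F U) (k : Fin n) :
    ContDiffOn ℝ ∞ (gradD G F k) U :=
  ContDiffOn.sum fun l _ => (h.contDiffOn_inv k l).mul (hF.partialD h.isOpen l)

theorem sum_mul_gradD (h : IsSmoothMetricOn G U) (hy : y ∈ U) (i : Fin n) :
    ∑ k, G y i k * gradD G F k y = partialD i F y :=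
  h.sum_mul_sum_inv hy (fun l => partialD l F y) i

theorem sum_partialD_gradD (h : IsSmoothMetricOn G U) (hF : ContDiffOn ℝ ∞ F U) (hy : y ∈ U)
    (i j : Fin n) :
    ∑ k, (partialD j (fun z => G z i k) y * gradD G F k y + G y i k * partialD j (gradD G F k) y)
      = partialD j (partialD i F) y := by
  have hd : ∀ k, DifferentiableAt ℝ (fun z => G z i k) y := fun k =>
    (h.contDiffOn i k).differentiableAt_of_isOpen h.isOpen hy
  have hd' : ∀ k, DifferentiableAt ℝ (gradD G F k) y := fun k =>
    (h.contDiffOn_gradD hF k).differentiableAt_of_isOpen h.isOpen hy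
  have := partialD_congr h.isOpen (fun z hz => h.sum_mul_gradD (F := F) hz i) hy j
  rw [partialD_sum (f := fun k z => G z i k * gradD G F k z)
    fun k _ => (hd k).fun_mul (hd' k)] at this
  rw [← this]
  exact Finset.sum_congr rfl fun k _ => (partialD_mul (hd k) (hd' k) j).symm

/-- The divergence of the gradient equals the trace of the Hessian. -/
theorem divergence_gradD (h : IsSmoothMetricOn G U) (hF : ContDiffOn ℝ ∞ F U) (hy : y ∈ U) :
    ∑ k, partialD k (gradD G F k) y + ∑ l, (∑ k, christoffel G k k l y) * gradD G F l y
      = ∑ i, ∑ j, (G y)⁻¹ i j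
          * (partialD j (partialD i F) y - ∑ l, christoffel G l i j y * partialD l F y) := by
  -- The covariant Hessian is the covariant derivative of the gradient with its index lowered, so
  -- its trace is the divergence.
  have h1 : ∀ i j, partialD j (partialD i F) y - ∑ l, christoffel G l i j y * partialD l F y
      = ∑ k, G y i k * (partialD j (gradD G F k) y
        + ∑ m, christoffel G k j m y * gradD G F m y) := by
    intro i j
    rw [← h.sum_partialD_gradD hF hy i j]
    have h2 : ∑ l, christoffel G l i j y * partialD l F y
        = ∑ m, (∑ l, G y m l * christoffel G l j i y) * gradD G F m y := by
      simp only [← h.sum_mul_gradD (F := F) hy, Finset.mul_sum, Finset.sum_mul]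
      rw [Finset.sum_comm]
      refine Finset.sum_congr rfl fun m _ => Finset.sum_congr rfl fun l _ => ?_
      rw [h.symm y hy, h.christoffel_symm hy l i j]
      ring
    have h3 : ∑ k, G y i k * ∑ m, christoffel G k j m y * gradD G F m y
        = ∑ m, (∑ l, G y i l * christoffel G l j m y) * gradD G F m y := by
      simp only [Finset.mul_sum, Finset.sum_mul]
      rw [Finset.sum_comm]
      refine Finset.sum_congr rfl fun m _ => Finset.sum_congr rfl fun l _ => by ring
    simp only [mul_add, Finset.sum_add_distrib, h.partialD_eq_christoffel hy, h2, h3, add_mul]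
    ring
  have h4 : ∀ v : Fin n → Fin n → ℝ,
      ∑ i, ∑ j, (G y)⁻¹ i j * ∑ k, G y i k * v k j = ∑ k, v k k := by
    intro v
    have : ∀ k j, ∑ i, (G y)⁻¹ i j * G y i k = if j = k then 1 else 0 := by
      intro k j
      have := congrFun (congrFun (h.inv_mul hy) j) k
      rw [Matrix.mul_apply, Matrix.one_apply] at this
      rw [← this]
      exact Finset.sum_congr rfl fun i _ => by rw [h.inv_symm hy]
    calc ∑ i, ∑ j, (G y)⁻¹ i j * ∑ k, G y i k * v k j
        = ∑ j, ∑ k, (∑ i, (G y)⁻¹ i j * G y i k) * v k j := by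
          rw [Finset.sum_comm]
          refine Finset.sum_congr rfl fun j _ => ?_
          simp only [Finset.mul_sum, Finset.sum_mul]
          rw [Finset.sum_comm]
          exact Finset.sum_congr rfl fun k _ => Finset.sum_congr rfl fun i _ => by ring
      _ = ∑ k, v k k := by simp [this]
  simp only [h1]
  rw [h4 fun k j => partialD j (gradD G F k) y + ∑ m, christoffel G k j m y * gradD G F m y,
    Finset.sum_add_distrib]
  congr 1
  simp only [Finset.sum_mul]
  rw [Finset.sum_comm]

theorem christoffel_conformal (h : IsSmoothMetricOn G U) (hF : ContDiffOn ℝ ∞ F U)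
    (hG' : ∀ z ∈ U, G' z = Real.exp (2 * F z) • G z) (hy : y ∈ U) (k i j : Fin n) :
    christoffel G' k i j y = christoffel G k i j y
      + conformalDiff (G y) (fun l => partialD l F y) (fun l => gradD G F l y) k i j := by
  have hinv : (G' y)⁻¹ = Real.exp (-(2 * F y)) • (G y)⁻¹ := by
    refine Matrix.inv_eq_right_inv ?_
    rw [hG' y hy, Matrix.smul_mul, Matrix.mul_smul, smul_smul, h.mul_inv hy, ← Real.exp_add]
    simp
  have hdF := hF.differentiableAt_of_isOpen h.isOpen hy
  have hdG : ∀ a b, DifferentiableAt ℝ (fun z => G z a b) y := fun a b =>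
    (h.contDiffOn a b).differentiableAt_of_isOpen h.isOpen hy
  have hexp : ∀ c, partialD c (fun z => Real.exp (2 * F z)) y
      = Real.exp (2 * F y) * 2 * partialD c F y := fun c => by
    refine partialD_comp (h := fun t => Real.exp (2 * t)) ?_ hdF c
    simpa using ((hasDerivAt_id (F y)).const_mul 2).exp
  have hd : ∀ a b c, partialD c (fun z => G' z a b) y
      = Real.exp (2 * F y) * (partialD c (fun z => G z a b) y + 2 * partialD c F y * G y a b) := by
    intro a b c
    rw [partialD_congr (g := fun z => Real.exp (2 * F z) * G z a b) h.isOpen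
      (fun z hz => by simp [hG' z hz]) hy,
      partialD_mul ((hdF.const_mul 2).exp) (hdG a b), hexp]
    ring
  have hone : ∀ i, ∑ l, (G y)⁻¹ k l * G y i l = if k = i then 1 else 0 := by
    intro i
    have := congrFun (congrFun (h.inv_mul hy) k) i
    rw [Matrix.mul_apply, Matrix.one_apply] at this
    rw [← this]
    exact Finset.sum_congr rfl fun l _ => by rw [h.symm y hy]
  have hexp1 : Real.exp (-(2 * F y)) * Real.exp (2 * F y) = 1 := by
    rw [← Real.exp_add]; simp
  have hterm : ∀ l, (G' y)⁻¹ k l * (partialD i (fun z => G' z j l) y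
        + partialD j (fun z => G' z i l) y - partialD l (fun z => G' z i j) y)
      = (G y)⁻¹ k l * (partialD i (fun z => G z j l) y
        + partialD j (fun z => G z i l) y - partialD l (fun z => G z i j) y)
        + (2 * partialD i F y * ((G y)⁻¹ k l * G y j l)
          + 2 * partialD j F y * ((G y)⁻¹ k l * G y i l)
          - 2 * G y i j * ((G y)⁻¹ k l * partialD l F y)) := by
    intro l
    rw [hd, hd, hd, hinv, Matrix.smul_apply, smul_eq_mul]
    linear_combination ((G y)⁻¹ k l * (partialD i (fun z => G z j l) y
      + 2 * partialD i F y * G y j l + partialD j (fun z => G z i l) y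
      + 2 * partialD j F y * G y i l - partialD l (fun z => G z i j) y
      - 2 * partialD l F y * G y i j)) * hexp1
  unfold christoffel
  simp only [hterm, Finset.sum_add_distrib, Finset.sum_sub_distrib, ← Finset.mul_sum, hone]
  unfold conformalDiff gradD
  split_ifs <;> ring

theorem ricciTensor_conformal (h : IsSmoothMetricOn G U) (hF : ContDiffOn ℝ ∞ F U)
    (hG' : ∀ z ∈ U, G' z = Real.exp (2 * F z) • G z) (hy : y ∈ U) (i j : Fin n) :
    ricciTensor G' y i j = ricciTensor G y i j
        - ((n : ℝ) - 2) * (partialD j (partialD i F) y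
          - ∑ l, christoffel G l i j y * partialD l F y - partialD i F y * partialD j F y)
        - (∑ k, partialD k (gradD G F k) y + ∑ l, (∑ k, christoffel G k k l y) * gradD G F l y
          + ((n : ℝ) - 2) * ∑ k, partialD k F y * gradD G F k y) * G y i j := by
  have hdF : ∀ k, DifferentiableAt ℝ (partialD k F) y := fun k =>
    (hF.partialD h.isOpen k).differentiableAt_of_isOpen h.isOpen hy
  have hdFu : ∀ k, DifferentiableAt ℝ (gradD G F k) y := fun k =>
    (h.contDiffOn_gradD hF k).differentiableAt_of_isOpen h.isOpen hy
  have hdG : ∀ a b, DifferentiableAt ℝ (fun z => G z a b) y := fun a b =>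
    (h.contDiffOn a b).differentiableAt_of_isOpen h.isOpen hy
  have hdC : ∀ k a b, DifferentiableAt ℝ (christoffel G k a b) y := fun k a b =>
    (h.contDiffOn_christoffel k a b).differentiableAt_of_isOpen h.isOpen hy
  have hite : ∀ (p : Prop) [Decidable p] (b : Fin n),
      DifferentiableAt ℝ (fun z => if p then partialD b F z else 0) y := by
    intro p _ b
    split_ifs
    · exact hdF b
    · exact differentiableAt_const _
  have hd : ∀ k a b c, partialD c (christoffel G' k a b) y
      = partialD c (christoffel G k a b) y
        + ((if k = a then partialD c (partialD b F) y else 0)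
          + (if k = b then partialD c (partialD a F) y else 0)
          - (partialD c (fun z => G z a b) y * gradD G F k y
            + G y a b * partialD c (gradD G F k) y)) := by
    intro k a b c
    rw [partialD_congr h.isOpen (fun z hz => h.christoffel_conformal hF hG' hz k a b) hy]
    unfold conformalDiff
    rw [partialD_add (hdC k a b)
        (((hite _ b).fun_add (hite _ a)).fun_sub ((hdG a b).fun_mul (hdFu k))),
      partialD_sub ((hite _ b).fun_add (hite _ a)) ((hdG a b).fun_mul (hdFu k)),
      partialD_add (hite _ b) (hite _ a), partialD_mul (hdG a b) (hdFu k),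
      partialD_ite, partialD_ite]
  have := ricci_conformal_algebra (g := G y) (H := fun a b => partialD b (partialD a F) y)
    (F := fun l => partialD l F y) (Fu := fun l => gradD G F l y)
    (C := fun k a b => christoffel G k a b y) (dg := fun k a b => partialD k (fun z => G z a b) y)
    (dFu := fun k l => partialD l (gradD G F k) y)
    (dC := fun k a b c => partialD c (christoffel G k a b) y)
    (h.symm y hy) (h.sum_mul_gradD hy) (fun a b => partialD_comm hF h.isOpen hy b a)
    (h.sum_partialD_gradD hF hy) (h.christoffel_symm hy) (h.partialD_eq_christoffel hy) i j
  unfold ricciTensor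
  simp only [Matrix.of_apply, hd, h.christoffel_conformal hF hG' hy]
  rw [← this]
  simp

/-- The Schouten tensor of the conformal metric `e^{2F} g`. -/
theorem schoutenTensor_conformal (hn : 3 ≤ n) (h : IsSmoothMetricOn G U)
    (hF : ContDiffOn ℝ ∞ F U) (hG' : ∀ z ∈ U, G' z = Real.exp (2 * F z) • G z) (hy : y ∈ U)
    (i j : Fin n) :
    schoutenTensor G' y i j = schoutenTensor G y i j
      - (partialD j (partialD i F) y - ∑ l, christoffel G l i j y * partialD l F y)
      + partialD i F y * partialD j F y
      - (1 / 2) * (∑ k, partialD k F y * gradD G F k y) * G y i j := by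
  have hn' : (3 : ℝ) ≤ n := by exact_mod_cast hn
  set N : ℝ := ∑ k, partialD k F y * gradD G F k y with hN
  set L : ℝ := ∑ k, partialD k (gradD G F k) y
    + ∑ l, (∑ k, christoffel G k k l y) * gradD G F l y with hL
  have hinv : (G' y)⁻¹ = Real.exp (-(2 * F y)) • (G y)⁻¹ := by
    refine Matrix.inv_eq_right_inv ?_
    rw [hG' y hy, Matrix.smul_mul, Matrix.mul_smul, smul_smul, h.mul_inv hy, ← Real.exp_add]
    simp
  have hric := fun a b => h.ricciTensor_conformal hF hG' hy a b
  simp only [← hN, ← hL] at hric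
  have htr : ∑ a, ∑ b, (G y)⁻¹ a b * G y a b = n := by
    have : ∀ a, ∑ b, (G y)⁻¹ a b * G y a b = 1 := by
      intro a
      have := congrFun (congrFun (h.inv_mul hy) a) a
      rw [Matrix.mul_apply, Matrix.one_apply_eq] at this
      rw [← this]
      exact Finset.sum_congr rfl fun b _ => by rw [h.symm y hy]
    simp [this]
  have hNN : ∑ a, ∑ b, (G y)⁻¹ a b * (partialD a F y * partialD b F y) = N := by
    rw [hN]
    unfold gradD
    simp only [Finset.mul_sum]
    exact Finset.sum_congr rfl fun a _ => Finset.sum_congr rfl fun b _ => by ring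
  have hLL := h.divergence_gradD hF hy
  rw [← hL] at hLL
  -- Trace of the Ricci formula: tr g = n, tr(dF ⊗ dF) = N, and the trace of the Hessian is the
  -- divergence L. In the Schouten combination L then cancels.
  have hR : scalarCurvature G' y = Real.exp (-(2 * F y)) * (scalarCurvature G y
      - ((n : ℝ) - 2) * (L - N) - (L + ((n : ℝ) - 2) * N) * n) := by
    have hsum : scalarCurvature G' y = Real.exp (-(2 * F y)) * (scalarCurvature G y
        - ((n : ℝ) - 2) * (∑ a, ∑ b, (G y)⁻¹ a b * (partialD b (partialD a F) y
            - ∑ l, christoffel G l a b y * partialD l F y)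
          - ∑ a, ∑ b, (G y)⁻¹ a b * (partialD a F y * partialD b F y))
        - (L + ((n : ℝ) - 2) * N) * ∑ a, ∑ b, (G y)⁻¹ a b * G y a b) := by
      unfold scalarCurvature
      simp only [hric, hinv, Matrix.smul_apply, smul_eq_mul, Finset.mul_sum (s := Finset.univ),
        ← Finset.sum_sub_distrib]
      exact Finset.sum_congr rfl fun a _ => Finset.sum_congr rfl fun b _ => by ring
    rw [hsum, hNN, htr, ← hLL]
  have hexp1 : Real.exp (-(2 * F y)) * Real.exp (2 * F y) = 1 := by
    rw [← Real.exp_add]; simp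
  simp only [schoutenTensor, Matrix.smul_apply, Matrix.sub_apply, smul_eq_mul, hric, hR,
    hG' y hy]
  have e1 : (n : ℝ) - 2 ≠ 0 := by linarith
  have e2 : (n : ℝ) - 1 ≠ 0 := by linarith
  rw [show ∀ X : ℝ, Real.exp (-(2 * F y)) * X / (2 * ((n : ℝ) - 1)) * (Real.exp (2 * F y) * G y i j)
    = X / (2 * ((n : ℝ) - 1)) * G y i j from fun X => by
      linear_combination (X / (2 * ((n : ℝ) - 1)) * G y i j) * hexp1]
  field_simp
  ring

end IsSmoothMetricOn

end ConformalChange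

/-! ### Coefficients of the Riemannian metric in a chart -/

section MetricInChart

attribute [local instance 2000] chartedSpaceSelf

variable {n : ℕ} {M : Type*} [MetricSpace M] [ChartedSpace (EuclideanSpace ℝ (Fin n)) M]
  [RiemannianBundle (fun x : M => TangentSpace (𝓡 n) x)]
  {e : OpenPartialHomeomorph M (EuclideanSpace ℝ (Fin n))} {y : EuclideanSpace ℝ (Fin n)}

theorem metricInChart_symm (i j : Fin n) : metricInChart e y i j = metricInChart e y j i := by
  simp only [metricInChart, Matrix.of_apply]
  exact real_inner_comm _ _

theorem contDiffOn_metricInChart [IsManifold (𝓡 n) ∞ M]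
    [IsContMDiffRiemannianBundle (𝓡 n) ∞ (EuclideanSpace ℝ (Fin n))
      (fun x : M => TangentSpace (𝓡 n) x)]
    (he : e ∈ IsManifold.maximalAtlas (𝓡 n) ∞ M) (i j : Fin n) :
    ContDiffOn ℝ ∞ (fun z => metricInChart e z i j) e.target := by
  have : IsManifold (𝓡 n) 1 M := IsManifold.of_le (n := ∞) (by exact_mod_cast le_top)
  have hsymm : ContMDiffOn (𝓡 n) (𝓡 n) ∞ e.symm e.target :=
    contMDiffOn_symm_of_mem_maximalAtlas he
  have huniq : UniqueMDiffOn (𝓡 n) e.target := e.open_target.uniqueMDiffOn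
  have htan := hsymm.contMDiffOn_tangentMapWithin (m := ∞) (by simp) huniq
  have hvec : ∀ i : Fin n, ContMDiffOn (𝓡 n) (𝓡 n).tangent ∞
      (fun z : EuclideanSpace ℝ (Fin n) => (TotalSpace.mk (e.symm z)
        (mfderiv (𝓡 n) (𝓡 n) e.symm z
          (EuclideanSpace.single i (1 : ℝ) : EuclideanSpace ℝ (Fin n))) :
        TangentBundle (𝓡 n) M)) e.target := by
    intro i
    have hc : ContMDiff (𝓡 n) (𝓡 n).tangent ∞
        (fun z : EuclideanSpace ℝ (Fin n) => (TotalSpace.mk z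
          (EuclideanSpace.single i (1 : ℝ) : EuclideanSpace ℝ (Fin n)) :
          TangentBundle (𝓡 n) (EuclideanSpace ℝ (Fin n)))) := by
      intro z
      exact contMDiffAt_vectorSpace_iff_contDiffAt.2 contDiffAt_const
    refine (htan.comp hc.contMDiffOn (fun z hz => hz)).congr fun z hz => ?_
    simp only [Function.comp_apply, tangentMapWithin]
    rw [mfderivWithin_of_isOpen e.open_target hz]
  have := ContMDiffOn.inner_bundle (hvec i) (hvec j)
  exact contMDiffOn_iff_contDiffOn.1 this

theorem metricInChart_quadratic (v : Fin n → ℝ) :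
    v ⬝ᵥ (metricInChart e y).mulVec v
      = inner ℝ (mfderiv (𝓡 n) (𝓡 n) e.symm y (WithLp.toLp 2 v : EuclideanSpace ℝ (Fin n)))
          (mfderiv (𝓡 n) (𝓡 n) e.symm y (WithLp.toLp 2 v : EuclideanSpace ℝ (Fin n))) := by
  have hv : (WithLp.toLp 2 v : EuclideanSpace ℝ (Fin n))
      = ∑ i, v i • (EuclideanSpace.single i (1 : ℝ) : EuclideanSpace ℝ (Fin n)) := by
    ext j
    simp [Pi.single_apply]
  have hL : mfderiv (𝓡 n) (𝓡 n) e.symm y (WithLp.toLp 2 v : EuclideanSpace ℝ (Fin n))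
      = ∑ i, v i • mfderiv (𝓡 n) (𝓡 n) e.symm y
        (EuclideanSpace.single i (1 : ℝ) : EuclideanSpace ℝ (Fin n)) := by
    rw [hv]
    exact (map_sum (mfderiv (𝓡 n) (𝓡 n) e.symm y) _ _).trans
      (Finset.sum_congr rfl fun i _ => map_smul _ _ _)
  rw [hL, sum_inner]
  simp only [inner_sum, inner_smul_left, inner_smul_right, dotProduct, Matrix.mulVec,
    Finset.mul_sum, metricInChart, Matrix.of_apply]
  exact Finset.sum_congr rfl fun i _ => Finset.sum_congr rfl fun j _ => by simp; ring

theorem metricInChart_pos [IsManifold (𝓡 n) ∞ M]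
    (he : e ∈ IsManifold.maximalAtlas (𝓡 n) ∞ M) (hy : y ∈ e.target) {v : Fin n → ℝ}
    (hv : v ≠ 0) : 0 < v ⬝ᵥ (metricInChart e y).mulVec v := by
  rw [metricInChart_quadratic, real_inner_self_eq_norm_sq]
  have hmd : e.MDifferentiable (𝓡 n) (𝓡 n) :=
    ⟨(contMDiffOn_of_mem_maximalAtlas he).mdifferentiableOn (by simp),
      (contMDiffOn_symm_of_mem_maximalAtlas he).mdifferentiableOn (by simp)⟩
  have hinj := hmd.symm.mfderiv_injective (x := y) hy
  have : mfderiv (𝓡 n) (𝓡 n) e.symm y (WithLp.toLp 2 v : EuclideanSpace ℝ (Fin n)) ≠ 0 := by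
    intro h0
    have h1 := hinj (h0.trans (map_zero (mfderiv (𝓡 n) (𝓡 n) e.symm y)).symm)
    exact hv ((WithLp.toLp_eq_zero 2).1 h1)
  exact pow_pos (norm_pos_iff.2 this) 2

theorem isSmoothMetricOn_metricInChart [IsManifold (𝓡 n) ∞ M]
    [IsContMDiffRiemannianBundle (𝓡 n) ∞ (EuclideanSpace ℝ (Fin n))
      (fun x : M => TangentSpace (𝓡 n) x)]
    (he : e ∈ IsManifold.maximalAtlas (𝓡 n) ∞ M) :
    IsSmoothMetricOn (metricInChart e) e.target where
  isOpen := e.open_target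
  contDiffOn := contDiffOn_metricInChart he
  symm := fun _ _ => metricInChart_symm
  det_ne_zero := fun z hz hdet => by
    obtain ⟨v, hv, hv0⟩ := Matrix.exists_mulVec_eq_zero_iff.2 hdet
    have := metricInChart_pos he hz hv
    simp [hv0] at this

end MetricInChart

/-! ### Coordinate distance against Riemannian distance -/

section Distance

attribute [local instance 2000] chartedSpaceSelf
attribute [local instance] normedAddCommGroupTangentSpaceVectorSpace
attribute [local instance] normedSpaceTangentSpaceVectorSpace

open Set MeasureTheory in
/-- The chart around `x` is Lipschitz at `x` with respect to the Riemannian distance. -/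
theorem eventually_edist_extChartAt_le {n : ℕ} {M : Type*} [MetricSpace M]
    [ChartedSpace (EuclideanSpace ℝ (Fin n)) M] [IsManifold (𝓡 n) 1 M]
    [RiemannianBundle (fun x : M => TangentSpace (𝓡 n) x)]
    [IsContinuousRiemannianBundle (EuclideanSpace ℝ (Fin n))
      (fun x : M => TangentSpace (𝓡 n) x)] (x : M) :
    ∃ C : NNReal, 0 < C ∧ ∀ᶠ y in 𝓝 x,
      edist (extChartAt (𝓡 n) x x) (extChartAt (𝓡 n) x y)
        ≤ C * Manifold.riemannianEDist (𝓡 n) x y := by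
  obtain ⟨C, hC0, hC⟩ := eventually_enorm_mfderiv_extChartAt_lt (𝓡 n) x
  have hmem := Filter.inter_mem hC (extChartAt_source_mem_nhds (I := 𝓡 n) x)
  obtain ⟨c, hc, hcs⟩ := setOfPred_riemannianEDist_lt_subset_nhds (𝓡 n) hmem
  refine ⟨C, hC0, ?_⟩
  filter_upwards [eventually_riemannianEDist_lt (𝓡 n) x (c := c) (by exact_mod_cast hc)] with y hy
  -- A curve from x of length less than r < c stays in the region where the chart is defined and its
  -- differential is bounded by C, so its image has length at most C r.
  have hlen : ∀ r : ENNReal, Manifold.riemannianEDist (𝓡 n) x y < r → r < c →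
      edist (extChartAt (𝓡 n) x x) (extChartAt (𝓡 n) x y) ≤ C * r := by
    intro r hr hrc
    obtain ⟨γ, hγx, hγy, γ_smooth, hγ, -⟩ :=
      Manifold.exists_lt_locally_constant_of_riemannianEDist_lt hr zero_lt_one
    have hin : ∀ t ∈ Icc (0 : ℝ) 1, γ t ∈ {z | Manifold.riemannianEDist (𝓡 n) x z < c} := by
      intro t ht
      refine lt_of_le_of_lt ?_ (hγ.trans hrc)
      refine (Manifold.riemannianEDist_le_pathELength (γ := γ) (γ_smooth.contMDiffOn)
        hγx rfl ht.1).trans ?_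
      exact Manifold.pathELength_mono le_rfl ht.2
    have hsrc : ∀ t ∈ Icc (0 : ℝ) 1, γ t ∈ (chartAt (EuclideanSpace ℝ (Fin n)) x).source :=
      fun t ht => by simpa using (hcs (hin t ht)).2
    let γ' := extChartAt (𝓡 n) x ∘ γ
    have hγ' : ContMDiffOn 𝓘(ℝ, ℝ) (𝓡 n) 1 γ' (Icc 0 1) :=
      contMDiffOn_extChartAt.comp (t := (chartAt (EuclideanSpace ℝ (Fin n)) x).source)
        γ_smooth.contMDiffOn hsrc
    have hmain : ‖γ' 1 - γ' 0‖ₑ ≤ C * Manifold.pathELength (𝓡 n) γ 0 1 := by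
      calc
        ‖γ' 1 - γ' 0‖ₑ
      _ ≤ ∫⁻ t' in Icc 0 1, ‖derivWithin γ' (Icc 0 1) t'‖ₑ := by
        apply enorm_sub_le_lintegral_derivWithin_Icc_of_contDiffOn_Icc _ zero_le_one
        rwa [← contMDiffOn_iff_contDiffOn]
      _ = ∫⁻ t' in Icc 0 1, ‖mfderivWithin 𝓘(ℝ, ℝ) (𝓡 n) γ' (Icc 0 1) t' 1‖ₑ := by
        simp_rw [← fderivWithin_derivWithin, mfderivWithin_eq_fderivWithin]
        rfl
      _ ≤ ∫⁻ t' in Icc 0 1, C * ‖mfderivWithin 𝓘(ℝ, ℝ) (𝓡 n) γ (Icc 0 1) t' 1‖ₑ := by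
        apply setLIntegral_mono' measurableSet_Icc (fun t' ht' ↦ ?_)
        have h1 : mfderivWithin 𝓘(ℝ, ℝ) (𝓡 n) γ' (Icc 0 1) t' =
            (mfderiv (𝓡 n) (𝓡 n) (extChartAt (𝓡 n) x) (γ t'))
              ∘L (mfderivWithin 𝓘(ℝ, ℝ) (𝓡 n) γ (Icc 0 1) t') := by
          apply mfderiv_comp_mfderivWithin
          · exact mdifferentiableAt_extChartAt (hsrc t' ht')
          · exact (γ_smooth.mdifferentiable one_ne_zero).mdifferentiableOn _ ht'
          · rw [uniqueMDiffWithinAt_iff_uniqueDiffWithinAt]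
            exact uniqueDiffOn_Icc zero_lt_one _ ht'
        have h2 : mfderivWithin 𝓘(ℝ, ℝ) (𝓡 n) γ' (Icc 0 1) t' 1 =
            (mfderiv (𝓡 n) (𝓡 n) (extChartAt (𝓡 n) x) (γ t'))
              (mfderivWithin 𝓘(ℝ, ℝ) (𝓡 n) γ (Icc 0 1) t' 1) :=
          congr($h1 1)
        rw [h2]
        apply (ContinuousLinearMap.le_opENorm _ _).trans
        gcongr
        exact (hcs (hin t' ht')).1.le
      _ = C * Manifold.pathELength (𝓡 n) γ 0 1 := by
        rw [lintegral_const_mul' _ _ ENNReal.coe_ne_top,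
            Manifold.pathELength_eq_lintegral_mfderivWithin_Icc]
    rw [edist_comm, edist_eq_enorm_sub]
    have h0 : γ' 0 = extChartAt (𝓡 n) x x := by simp only [γ', Function.comp_apply, hγx]
    have h1 : γ' 1 = extChartAt (𝓡 n) x y := by simp only [γ', Function.comp_apply, hγy]
    rw [← h0, ← h1]
    exact hmain.trans (by gcongr)
  refine le_of_forall_gt fun b hb => ?_
  have hb' : Manifold.riemannianEDist (𝓡 n) x y < b / C := by
    rw [ENNReal.lt_div_iff_mul_lt (Or.inl (by exact_mod_cast hC0.ne')) (Or.inl ENNReal.coe_ne_top),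
      mul_comm]
    exact hb
  obtain ⟨r, hr, hr'⟩ := exists_between (lt_min hb' hy)
  refine (hlen r hr (hr'.trans_le (min_le_right _ _))).trans_lt ?_
  have := hr'.trans_le (min_le_left _ _)
  rwa [ENNReal.lt_div_iff_mul_lt (Or.inl (by exact_mod_cast hC0.ne')) (Or.inl ENNReal.coe_ne_top),
      mul_comm] at this

end Distance

/-! ### Membership criteria for the cone -/

section Cone

variable {n : ℕ} {Γ : Set (Fin n → ℝ)}

namespace IsAdmissibleCone

theorem add_mem (hΓ : IsAdmissibleCone Γ) {a b : Fin n → ℝ} (ha : a ∈ Γ) (hb : b ∈ Γ) :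
    a + b ∈ Γ := by
  have h := hΓ.convex ha hb (a := 1 / 2) (b := 1 / 2) (by norm_num) (by norm_num) (by norm_num)
  have := hΓ.cone 2 two_pos _ h
  rwa [smul_add, smul_smul, smul_smul, mul_one_div_cancel two_ne_zero, one_smul, one_smul] at this

/-- Openness allows a small constant to be subtracted from `a`; what must be added to reach `b` is
then a positive vector, and Γ is closed under addition. -/
theorem mem_of_le (hΓ : IsAdmissibleCone Γ) {a b : Fin n → ℝ} (ha : a ∈ Γ)
    (hab : ∀ i, a i ≤ b i) : b ∈ Γ := by
  have hc : Continuous fun ε : ℝ => a - fun _ => ε := by fun_prop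
  have h0 : (fun ε : ℝ => a - fun _ => ε) ⁻¹' Γ ∈ 𝓝 (0 : ℝ) := by
    refine (hΓ.isOpen.preimage hc).mem_nhds ?_
    have : (a - fun _ => (0 : ℝ)) = a := by ext; simp
    simpa [this] using ha
  obtain ⟨ε, hε, hball⟩ := Metric.mem_nhds_iff.1 h0
  have h1 : (a - fun _ => ε / 2) ∈ Γ := hball (by
    rw [Metric.mem_ball, Real.dist_eq, sub_zero, abs_of_pos (by linarith)]; linarith)
  have h2 : (b - a + fun _ => ε / 2) ∈ Γ := hΓ.pos_subset fun i => by
    simp only [Pi.add_apply, Pi.sub_apply]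
    linarith [hab i]
  have := hΓ.add_mem h1 h2
  rwa [show (a - fun _ => ε / 2) + (b - a + fun _ => ε / 2) = b by ext; simp] at this

/-- The vector lies on the segment from a point of the closure to the interior point (1, ..., 1) and
differs from the former, so it is interior. -/
theorem muVec_mem (hΓ : IsAdmissibleCone Γ) (hn : 1 ≤ n) {μ : ℝ} (hμ0 : 0 ≤ μ)
    (hμ : μ < muPlus Γ) : muVec n μ ∈ Γ := by
  have hcl : muVec n (muPlus Γ) ∈ closure Γ := frontier_subset_closure (muPlus_spec hn hΓ).2
  have hint : muVec n (-1) ∈ interior Γ := by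
    rw [hΓ.isOpen.interior_eq]
    refine hΓ.pos_subset fun i => ?_
    unfold muVec
    split_ifs <;> norm_num
  have hd : (0 : ℝ) < muPlus Γ + 1 := by linarith
  have h1 : (0 : ℝ) ≤ (μ + 1) / (muPlus Γ + 1) := by positivity
  have h2 : (0 : ℝ) < (muPlus Γ - μ) / (muPlus Γ + 1) := div_pos (by linarith) hd
  have h3 : (μ + 1) / (muPlus Γ + 1) + (muPlus Γ - μ) / (muPlus Γ + 1) = 1 := by
    field_simp
    ring
  have h := hΓ.convex.combo_closure_interior_mem_interior hcl hint h1 h2 h3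
  have heq : ((μ + 1) / (muPlus Γ + 1)) • muVec n (muPlus Γ)
      + ((muPlus Γ - μ) / (muPlus Γ + 1)) • muVec n (-1) = muVec n μ := by
    ext i
    simp only [Pi.add_apply, Pi.smul_apply, smul_eq_mul, muVec]
    split_ifs
    · field_simp
      ring
    · rw [mul_one, mul_one, h3]
  rw [heq] at h
  exact interior_subset h

/-- The permutations of `muVec n μ` are the vectors 1 - (1+μ)e_j. Averaging them with weights q
gives 1 - (1+μ)q, so a rank-one perturbation need not be aligned with an eigenvector. -/
theorem mem_of_simplex (hΓ : IsAdmissibleCone Γ) (hn : 1 ≤ n) {μ : ℝ} (hμ0 : 0 ≤ μ)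
    (hμ : μ < muPlus Γ) {T : ℝ} (hT : 0 < T) {q lam : Fin n → ℝ} (hq : ∀ i, 0 ≤ q i)
    (hsum : ∑ i, q i ≤ 1) (hlam : ∀ i, T * (1 - (1 + μ) * q i) ≤ lam i) : lam ∈ Γ := by
  obtain ⟨m, rfl⟩ : ∃ m, n = m + 1 := ⟨n - 1, by omega⟩
  have hv : ∀ j : Fin (m + 1), (fun i => 1 - (1 + μ) * if i = j then 1 else 0) ∈ Γ := by
    intro j
    convert! hΓ.symmetric (Equiv.swap 0 j) _ (hΓ.muVec_mem hn hμ0 hμ) using 1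
    ext i
    simp only [Function.comp_apply, muVec]
    have : ((Equiv.swap 0 j i : Fin (m + 1)) : ℕ) = 0 ↔ i = j := by
      rw [Fin.val_eq_zero_iff, Equiv.swap_apply_eq_iff, Equiv.swap_apply_left]
    simp only [this]
    split_ifs <;> ring
  -- The missing mass goes to index 0; this only lowers the average, and `mem_of_le` recovers the
  -- loss.
  let p : Fin (m + 1) → ℝ := fun i => q i + if i = 0 then 1 - ∑ i, q i else 0
  have hp : ∀ i, q i ≤ p i := fun i => by
    simp only [p]
    split_ifs <;> linarith
  have hp1 : ∑ i, p i = 1 := by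
    simp [p, Finset.sum_add_distrib]
  have h := hΓ.convex.sum_mem (t := Finset.univ) (w := p) (fun i _ => (hq i).trans (hp i)) hp1
    (fun j _ => hv j)
  refine hΓ.mem_of_le (hΓ.cone T hT _ h) fun i => le_trans ?_ (hlam i)
  simp only [Pi.smul_apply, Finset.sum_apply, smul_eq_mul]
  refine mul_le_mul_of_nonneg_left ?_ hT.le
  have : ∑ j, p j * (1 - (1 + μ) * if i = j then 1 else 0) = 1 - (1 + μ) * p i := by
    simp only [mul_sub, mul_one, Finset.sum_sub_distrib, hp1]
    simp
    ring
  rw [this]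
  nlinarith [hp i]

end IsAdmissibleCone

open Matrix in
/-- If the form `A` is bounded from below by `T (g - (1 + μ) κ w ⊗ w)` with `κ |w|_g² ≤ 1`, then
its eigenvalues lie in `Γ`. -/
theorem IsEigenvalueTuple.mem_cone (hΓ : IsAdmissibleCone Γ) (hn : 1 ≤ n) {μ : ℝ} (hμ0 : 0 ≤ μ)
    (hμ : μ < muPlus Γ) {A G : Matrix (Fin n) (Fin n) ℝ} {lam : Fin n → ℝ} {s T κ : ℝ}
    (hs : 0 < s) (hT : 0 < T) (hκ : 0 ≤ κ) (hlam : IsEigenvalueTuple A (s • G) lam)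
    (w : Fin n → ℝ) (hw : κ * (w ⬝ᵥ G⁻¹ *ᵥ w) ≤ 1)
    (hA : ∀ v : Fin n → ℝ, T * (v ⬝ᵥ G *ᵥ v - (1 + μ) * (κ * (w ⬝ᵥ v) ^ 2)) ≤ v ⬝ᵥ A *ᵥ v) :
    lam ∈ Γ := by
  obtain ⟨P, hPG, hPA⟩ := hlam
  have hcol : ∀ (B : Matrix (Fin n) (Fin n) ℝ) (i : Fin n),
      (Pᵀ * B * P) i i = (P.col i) ⬝ᵥ B *ᵥ (P.col i) := by
    intro B i
    rw [Matrix.mul_assoc, Matrix.mul_apply, dotProduct]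
    refine Finset.sum_congr rfl fun k _ => ?_
    rw [Matrix.mul_apply, Matrix.mulVec, dotProduct]
    rfl
  have hGi : ∀ i, (P.col i) ⬝ᵥ G *ᵥ (P.col i) = s⁻¹ := by
    intro i
    have h := hcol (s • G) i
    rw [hPG, Matrix.one_apply_eq, Matrix.smul_mulVec, dotProduct_smul, smul_eq_mul] at h
    field_simp
    linarith
  have hAi : ∀ i, (P.col i) ⬝ᵥ A *ᵥ (P.col i) = lam i := by
    intro i
    rw [← hcol, hPA, Matrix.diagonal_apply_eq]
  -- Completeness of the orthonormal basis: it turns the sum of squared components of `w` into its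
  -- dual norm, so these squares can serve as simplex weights.
  have hPP : P * Pᵀ = s⁻¹ • G⁻¹ := by
    have h1 : P * (Pᵀ * (s • G)) = 1 := mul_eq_one_comm.1 hPG
    have h2 : (s • (P * Pᵀ)) * G = 1 := by
      rw [← h1, ← Matrix.mul_assoc, Matrix.mul_smul, Matrix.smul_mul]
    rw [Matrix.inv_eq_left_inv h2, smul_smul, inv_mul_cancel₀ hs.ne', one_smul]
  have hsumw : ∑ i, (w ⬝ᵥ P.col i) ^ 2 = s⁻¹ * (w ⬝ᵥ G⁻¹ *ᵥ w) := by
    have h1 : ∑ i, (w ⬝ᵥ P.col i) ^ 2 = (Pᵀ *ᵥ w) ⬝ᵥ (Pᵀ *ᵥ w) := by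
      rw [dotProduct]
      refine Finset.sum_congr rfl fun i _ => ?_
      rw [sq, Matrix.mulVec, dotProduct_comm w]
      rfl
    rw [h1, Matrix.dotProduct_mulVec, Matrix.vecMul_transpose, Matrix.mulVec_mulVec, hPP,
      Matrix.smul_mulVec, smul_dotProduct, smul_eq_mul, dotProduct_comm]
  refine hΓ.mem_of_simplex hn hμ0 hμ (T := T * s⁻¹) (by positivity)
    (q := fun i => κ * s * (w ⬝ᵥ P.col i) ^ 2) (fun i => by positivity) ?_ fun i => ?_
  · rw [← Finset.mul_sum, hsumw]
    calc κ * s * (s⁻¹ * (w ⬝ᵥ G⁻¹ *ᵥ w)) = κ * (w ⬝ᵥ G⁻¹ *ᵥ w) := by field_simp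
      _ ≤ 1 := hw
  · have := hA (P.col i)
    rw [hGi, hAi] at this
    refine le_trans (le_of_eq ?_) this
    field_simp

end Cone

/-! ### Comparison of the metric with its value at the centre -/

section LocalBounds

open Matrix Asymptotics

variable {n : ℕ}

theorem exists_forall_abs_le_of_isBigO {ι α : Type*} [Fintype ι] {l : Filter α} {f : ι → α → ℝ}
    {g : α → ℝ} (h : ∀ i, f i =O[l] g) :
    ∃ K > 0, ∀ᶠ x in l, ∀ i, |f i x| ≤ K * |g x| := by
  obtain ⟨K, hK, hb⟩ := (isBigO_pi.2 h : (fun x i => f i x) =O[l] g).exists_pos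
  refine ⟨K, hK, hb.bound.mono fun x hx i => ?_⟩
  exact (norm_le_pi_norm (fun i => f i x) i).trans hx

theorem abs_le_norm_toLp (v : Fin n → ℝ) (i : Fin n) :
    |v i| ≤ ‖(WithLp.toLp 2 v : EuclideanSpace ℝ (Fin n))‖ :=
  PiLp.norm_apply_le (WithLp.toLp 2 v : EuclideanSpace ℝ (Fin n)) i

theorem abs_quadratic_le {B : Matrix (Fin n) (Fin n) ℝ} {β : ℝ} (hB : ∀ i j, |B i j| ≤ β)
    (v : Fin n → ℝ) :
    |v ⬝ᵥ B *ᵥ v| ≤ n ^ 2 * β * ‖(WithLp.toLp 2 v : EuclideanSpace ℝ (Fin n))‖ ^ 2 := by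
  set N := ‖(WithLp.toLp 2 v : EuclideanSpace ℝ (Fin n))‖ with hN
  simp only [dotProduct, mulVec, Finset.mul_sum]
  have : ∀ i j, |v i * (B i j * v j)| ≤ β * N ^ 2 := by
    intro i j
    rw [abs_mul, abs_mul]
    have h1 := abs_le_norm_toLp v i
    have h2 := abs_le_norm_toLp v j
    calc |v i| * (|B i j| * |v j|) ≤ N * (β * N) := by
          have := (abs_nonneg (B i j)).trans (hB i j)
          gcongr
          exact hB i j
      _ = β * N ^ 2 := by ring
  calc |∑ i, ∑ j, v i * (B i j * v j)| ≤ ∑ i : Fin n, ∑ j : Fin n, β * N ^ 2 :=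
        (Finset.abs_sum_le_sum_abs _ _).trans (Finset.sum_le_sum fun i _ =>
          (Finset.abs_sum_le_sum_abs _ _).trans (Finset.sum_le_sum fun j _ => this i j))
    _ = n ^ 2 * β * N ^ 2 := by simp; ring

theorem exists_quadratic_ge {B : Matrix (Fin n) (Fin n) ℝ}
    (hB : ∀ v : Fin n → ℝ, v ≠ 0 → 0 < v ⬝ᵥ B *ᵥ v) :
    ∃ m > 0, ∀ v : Fin n → ℝ,
      m * ‖(WithLp.toLp 2 v : EuclideanSpace ℝ (Fin n))‖ ^ 2 ≤ v ⬝ᵥ B *ᵥ v := by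
  let f : EuclideanSpace ℝ (Fin n) → ℝ := fun v => v.ofLp ⬝ᵥ B *ᵥ v.ofLp
  have hf : Continuous f := by
    simp only [f, dotProduct, mulVec]
    fun_prop
  have hpos : ∀ v : EuclideanSpace ℝ (Fin n), v ≠ 0 → 0 < f v := fun v hv =>
    hB _ fun h => hv ((WithLp.ofLp_eq_zero 2).1 h)
  have hsmul : ∀ (c : ℝ) v, f (c • v) = c ^ 2 * f v := by
    intro c v
    simp only [f, WithLp.ofLp_smul, mulVec_smul, dotProduct_smul, smul_dotProduct, smul_eq_mul]
    ring
  by_cases hne : (Metric.sphere (0 : EuclideanSpace ℝ (Fin n)) 1).Nonempty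
  · obtain ⟨w, hw, hmin⟩ := (isCompact_sphere _ _).exists_isMinOn hne hf.continuousOn
    have hw1 : ‖w‖ = 1 := by simpa using hw
    refine ⟨f w, hpos w fun h => by simp [h] at hw1, fun v => ?_⟩
    by_cases hv : (WithLp.toLp 2 v : EuclideanSpace ℝ (Fin n)) = 0
    · have : v = 0 := (WithLp.toLp_eq_zero 2).1 hv
      simp [this]
    · set V : EuclideanSpace ℝ (Fin n) := WithLp.toLp 2 v with hV
      have hVn : 0 < ‖V‖ := norm_pos_iff.2 hv
      have h1 : f w ≤ f (‖V‖⁻¹ • V) := hmin (by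
        simp [norm_smul, hVn.ne'])
      rw [hsmul] at h1
      have h2 : f V = v ⬝ᵥ B *ᵥ v := rfl
      rw [← h2]
      calc f w * ‖V‖ ^ 2 ≤ (‖V‖⁻¹ ^ 2 * f V) * ‖V‖ ^ 2 := by gcongr
        _ = f V := by field_simp
  -- The unit sphere is empty only in dimension 0, where every vector vanishes.
  · refine ⟨1, one_pos, fun v => ?_⟩
    by_cases hv : (WithLp.toLp 2 v : EuclideanSpace ℝ (Fin n)) = 0
    · have : v = 0 := (WithLp.toLp_eq_zero 2).1 hv
      simp [this]
    · refine absurd ⟨‖(WithLp.toLp 2 v : EuclideanSpace ℝ (Fin n))‖⁻¹ • WithLp.toLp 2 v, ?_⟩ hne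
      simp [norm_smul, (norm_pos_iff.2 hv).ne']

/-- The squared distance to `y₀` with respect to the constant metric `G y₀`. -/
def frozenSq (G : EuclideanSpace ℝ (Fin n) → Matrix (Fin n) (Fin n) ℝ)
    (y₀ y : EuclideanSpace ℝ (Fin n)) : ℝ :=
  (y - y₀).ofLp ⬝ᵥ G y₀ *ᵥ (y - y₀).ofLp

/-- The covector dual to `y - y₀` with respect to the constant metric `G y₀`. -/
def frozenFlat (G : EuclideanSpace ℝ (Fin n) → Matrix (Fin n) (Fin n) ℝ)
    (y₀ y : EuclideanSpace ℝ (Fin n)) : Fin n → ℝ :=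
  G y₀ *ᵥ (y - y₀).ofLp

variable {U : Set (EuclideanSpace ℝ (Fin n))} {y₀ : EuclideanSpace ℝ (Fin n)}
  {G : EuclideanSpace ℝ (Fin n) → Matrix (Fin n) (Fin n) ℝ}

theorem isBigO_one_of_contDiffOn {f : EuclideanSpace ℝ (Fin n) → ℝ} (hf : ContDiffOn ℝ ∞ f U)
    (hU : IsOpen U) (hy : y₀ ∈ U) : f =O[𝓝 y₀] fun _ => (1 : ℝ) :=
  (hf.differentiableAt_of_isOpen hU hy).continuousAt.norm.isBoundedUnder_le.isBigO_one ℝ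

theorem isBigO_norm_sub_of_contDiffOn {f : EuclideanSpace ℝ (Fin n) → ℝ}
    (hf : ContDiffOn ℝ ∞ f U) (hU : IsOpen U) (hy : y₀ ∈ U) :
    (fun y => f y - f y₀) =O[𝓝 y₀] fun y => ‖y - y₀‖ :=
  (hf.differentiableAt_of_isOpen hU hy).isBigO_sub.norm_right

/-- Near `y₀` the metric `G` is close to the constant metric `G y₀`. -/
theorem IsSmoothMetricOn.exists_local_bounds (h : IsSmoothMetricOn G U)
    (hpos : ∀ v : Fin n → ℝ, v ≠ 0 → 0 < v ⬝ᵥ G y₀ *ᵥ v) (hy₀ : y₀ ∈ U) :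
    ∃ m > 0, ∃ C > 0, (∀ y, m * ‖y - y₀‖ ^ 2 ≤ frozenSq G y₀ y) ∧ ∀ᶠ y in 𝓝 y₀,
      frozenFlat G y₀ y ⬝ᵥ (G y)⁻¹ *ᵥ frozenFlat G y₀ y
        ≤ (1 + C * √(frozenSq G y₀ y)) * frozenSq G y₀ y ∧
      ∀ v : Fin n → ℝ, 0 ≤ v ⬝ᵥ G y *ᵥ v ∧
        -(C * (v ⬝ᵥ G y *ᵥ v)) ≤ v ⬝ᵥ schoutenTensor G y *ᵥ v ∧
        (1 - C * √(frozenSq G y₀ y)) * (v ⬝ᵥ G y *ᵥ v) ≤ v ⬝ᵥ G y₀ *ᵥ v ∧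
        v ⬝ᵥ (Matrix.of fun i j => ∑ l, christoffel G l i j y * frozenFlat G y₀ y l) *ᵥ v
          ≤ C * √(frozenSq G y₀ y) * (v ⬝ᵥ G y *ᵥ v) := by
  obtain ⟨m, hm, hmG⟩ := exists_quadratic_ge hpos
  obtain ⟨K₁, hK₁, hb₁⟩ := exists_forall_abs_le_of_isBigO
    (f := fun (p : Fin n × Fin n) y => schoutenTensor G y p.1 p.2) fun p =>
    isBigO_one_of_contDiffOn (h.contDiffOn_schoutenTensor p.1 p.2) h.isOpen hy₀
  obtain ⟨K₂, hK₂, hb₂⟩ := exists_forall_abs_le_of_isBigO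
    (f := fun (p : Fin n × Fin n) y => G y p.1 p.2 - G y₀ p.1 p.2) fun p =>
    isBigO_norm_sub_of_contDiffOn (h.contDiffOn p.1 p.2) h.isOpen hy₀
  have hflat : ∀ l, (fun y => frozenFlat G y₀ y l) =O[𝓝 y₀] fun y => ‖y - y₀‖ := by
    intro l
    simp only [frozenFlat, mulVec, dotProduct]
    refine IsBigO.fun_sum fun k _ => IsBigO.const_mul_left ?_ _
    exact IsBigO.of_norm_le fun y => PiLp.norm_apply_le (y - y₀) k
  obtain ⟨K₃, hK₃, hb₃⟩ := exists_forall_abs_le_of_isBigO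
    (f := fun (p : Fin n × Fin n) y => ∑ l, christoffel G l p.1 p.2 y * frozenFlat G y₀ y l)
    (g := fun y => ‖y - y₀‖) (l := 𝓝 y₀) fun p => by
      refine IsBigO.fun_sum fun l _ => ?_
      simpa using (isBigO_one_of_contDiffOn (h.contDiffOn_christoffel l p.1 p.2)
        h.isOpen hy₀).mul (hflat l)
  -- This matrix equals `G y₀` at `y₀`, and the dual norm of `frozenFlat` is its quadratic form at y
  -- - y₀, so the two squared radii differ by O(|y - y₀|³).
  have hsmooth : ∀ i j, ContDiffOn ℝ ∞ (fun y => (G y₀ * (G y)⁻¹ * G y₀) i j) U := by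
    intro i j
    simp only [Matrix.mul_apply]
    exact ContDiffOn.sum fun k _ => (ContDiffOn.sum fun l _ =>
      contDiffOn_const.mul (h.contDiffOn_inv l k)).mul contDiffOn_const
  obtain ⟨K₄, hK₄, hb₄⟩ := exists_forall_abs_le_of_isBigO
    (f := fun (p : Fin n × Fin n) y => (G y₀ * (G y)⁻¹ * G y₀) p.1 p.2
      - (G y₀ * (G y₀)⁻¹ * G y₀) p.1 p.2) fun p =>
    isBigO_norm_sub_of_contDiffOn (hsmooth p.1 p.2) h.isOpen hy₀
  rw [h.mul_inv hy₀, Matrix.one_mul] at hb₄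
  have hzρ : ∀ y, m * ‖y - y₀‖ ^ 2 ≤ frozenSq G y₀ y := fun y => hmG _
  have hρ0 : ∀ y, 0 ≤ frozenSq G y₀ y := fun y => le_trans (by positivity) (hzρ y)
  have hz : ∀ y, ‖y - y₀‖ ≤ (√m)⁻¹ * √(frozenSq G y₀ y) := by
    intro y
    have h1 := Real.sqrt_le_sqrt (hzρ y)
    rw [Real.sqrt_mul hm.le, Real.sqrt_sq (norm_nonneg _)] at h1
    rw [inv_mul_eq_div, le_div_iff₀ (Real.sqrt_pos.2 hm)]
    linarith
  -- Ensures that `G y` is bounded below by m/2, so Euclidean norms can be replaced by `G y`-norms.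
  have hsmall : ∀ᶠ y in 𝓝 y₀, n ^ 2 * K₂ * ‖y - y₀‖ ≤ m / 2 := by
    have hc : ContinuousAt (fun y => n ^ 2 * K₂ * ‖y - y₀‖) y₀ := by fun_prop
    have : (n ^ 2 * K₂ * ‖y₀ - y₀‖) < m / 2 := by simpa using hm
    exact (hc.eventually_lt continuousAt_const this).mono fun y hy => hy.le
  set s := (√m)⁻¹ with hs
  have hs0 : 0 ≤ s := by positivity
  refine ⟨m, hm, n ^ 2 * K₁ * (2 / m) + n ^ 2 * K₂ * s * (2 / m) + n ^ 2 * K₃ * s * (2 / m)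
    + n ^ 2 * K₄ * s * (1 / m) + 1, by positivity, hzρ, ?_⟩
  filter_upwards [hb₁, hb₂, hb₃, hb₄, hsmall] with y h₁ h₂ h₃ h₄ hsm
  simp only [abs_one, mul_one] at h₁
  simp only [abs_norm] at h₂ h₃ h₄
  set r := √(frozenSq G y₀ y) with hr
  have hr0 : 0 ≤ r := Real.sqrt_nonneg _
  have hzy := hz y
  set z := ‖y - y₀‖ with hzdef
  have hz0 : 0 ≤ z := norm_nonneg _
  have a1 : 0 ≤ n ^ 2 * K₁ * (2 / m) := by positivity
  have a2 : 0 ≤ n ^ 2 * K₂ * s * (2 / m) := by positivity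
  have a3 : 0 ≤ n ^ 2 * K₃ * s * (2 / m) := by positivity
  have a4 : 0 ≤ n ^ 2 * K₄ * s * (1 / m) := by positivity
  constructor
  · have e1 : frozenFlat G y₀ y ⬝ᵥ (G y)⁻¹ *ᵥ frozenFlat G y₀ y
        = (y - y₀).ofLp ⬝ᵥ (G y₀ * (G y)⁻¹ * G y₀) *ᵥ (y - y₀).ofLp := by
      have hT : (G y₀)ᵀ = G y₀ := Matrix.ext fun a b => h.symm y₀ hy₀ b a
      unfold frozenFlat
      rw [← Matrix.mulVec_mulVec, ← Matrix.mulVec_mulVec, Matrix.dotProduct_mulVec _ (G y₀),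
        ← Matrix.mulVec_transpose, hT]
    have e2 : frozenFlat G y₀ y ⬝ᵥ (G y)⁻¹ *ᵥ frozenFlat G y₀ y - frozenSq G y₀ y
        = (y - y₀).ofLp ⬝ᵥ (G y₀ * (G y)⁻¹ * G y₀ - G y₀) *ᵥ (y - y₀).ofLp := by
      rw [Matrix.sub_mulVec, dotProduct_sub, e1]
      rfl
    have e3 := (le_abs_self _).trans (abs_quadratic_le (B := G y₀ * (G y)⁻¹ * G y₀ - G y₀)
      (β := K₄ * z) (fun i j => h₄ (i, j)) (y - y₀).ofLp)
    rw [← e2] at e3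
    have e4 : ‖(WithLp.toLp 2 (y - y₀).ofLp : EuclideanSpace ℝ (Fin n))‖ = z := rfl
    rw [e4] at e3
    have e5 : z ^ 2 ≤ (1 / m) * frozenSq G y₀ y := by
      rw [one_div, inv_mul_eq_div, le_div_iff₀ hm]
      linarith [hzρ y]
    have e6 : n ^ 2 * (K₄ * z) * z ^ 2 ≤ n ^ 2 * (K₄ * (s * r)) * ((1 / m) * frozenSq G y₀ y) := by
      gcongr
    nlinarith [mul_nonneg (add_nonneg (add_nonneg (add_nonneg a1 a2) a3) zero_le_one)
      (mul_nonneg hr0 (hρ0 y))]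
  · intro v
    set g := v ⬝ᵥ G y *ᵥ v with hg
    set N := ‖(WithLp.toLp 2 v : EuclideanSpace ℝ (Fin n))‖ with hN
    have hdiff : |g - v ⬝ᵥ G y₀ *ᵥ v| ≤ n ^ 2 * (K₂ * z) * N ^ 2 := by
      have := abs_quadratic_le (B := G y - G y₀) (β := K₂ * z) (fun i j => h₂ (i, j)) v
      rwa [Matrix.sub_mulVec, dotProduct_sub] at this
    have hN2 : N ^ 2 ≤ (2 / m) * g := by
      have h1 := hmG v
      rw [← hN] at h1
      have h2 : n ^ 2 * K₂ * z * N ^ 2 ≤ m / 2 * N ^ 2 := by gcongr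
      have h3 := neg_abs_le (g - v ⬝ᵥ G y₀ *ᵥ v)
      rw [div_mul_eq_mul_div, le_div_iff₀ hm]
      nlinarith
    have hg0 : 0 ≤ g := by
      have : 0 ≤ (2 / m) * g := le_trans (sq_nonneg N) hN2
      exact nonneg_of_mul_nonneg_right this (by positivity)
    have hrg : 0 ≤ r * g := mul_nonneg hr0 hg0
    refine ⟨hg0, ?_, ?_, ?_⟩
    · have e1 := neg_abs_le (v ⬝ᵥ schoutenTensor G y *ᵥ v)
      have e2 := abs_quadratic_le (B := schoutenTensor G y) (β := K₁) (fun i j => h₁ (i, j)) v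
      have e3 : n ^ 2 * K₁ * N ^ 2 ≤ n ^ 2 * K₁ * ((2 / m) * g) := by gcongr
      nlinarith [mul_nonneg (add_nonneg (add_nonneg (add_nonneg a2 a3) a4) zero_le_one) hg0]
    · have e1 := le_abs_self (g - v ⬝ᵥ G y₀ *ᵥ v)
      have e3 : n ^ 2 * (K₂ * z) * N ^ 2 ≤ n ^ 2 * (K₂ * (s * r)) * ((2 / m) * g) := by gcongr
      nlinarith [mul_nonneg (add_nonneg (add_nonneg (add_nonneg a1 a3) a4) zero_le_one) hrg]
    · have e1 := (le_abs_self _).trans (abs_quadratic_le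
        (B := Matrix.of fun i j => ∑ l, christoffel G l i j y * frozenFlat G y₀ y l)
        (β := K₃ * z) (fun i j => h₃ (i, j)) v)
      have e3 : n ^ 2 * (K₃ * z) * N ^ 2 ≤ n ^ 2 * (K₃ * (s * r)) * ((2 / m) * g) := by gcongr
      refine (e1.trans e3).trans ?_
      nlinarith [mul_nonneg (add_nonneg (add_nonneg (add_nonneg a1 a2) a4) zero_le_one) hrg]

end LocalBounds

/-! ### The Schouten tensor for a radial conformal exponent -/

section Radial

open Matrix

variable {n : ℕ} {U V : Set (EuclideanSpace ℝ (Fin n))} {y₀ y : EuclideanSpace ℝ (Fin n)}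
  {G G' : EuclideanSpace ℝ (Fin n) → Matrix (Fin n) (Fin n) ℝ}

theorem contDiff_frozenFlat (k : Fin n) : ContDiff ℝ ∞ fun z => frozenFlat G y₀ z k := by
  simp only [frozenFlat, mulVec, dotProduct]
  fun_prop

theorem contDiff_frozenSq : ContDiff ℝ ∞ (frozenSq G y₀) := by
  unfold frozenSq
  simp only [mulVec, dotProduct]
  fun_prop

theorem partialD_coord_sub (i k : Fin n) :
    partialD i (fun z => (z - y₀).ofLp k) y = if k = i then 1 else 0 := by
  have : HasFDerivAt (fun z : EuclideanSpace ℝ (Fin n) => (z - y₀).ofLp k)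
      (EuclideanSpace.proj k : EuclideanSpace ℝ (Fin n) →L[ℝ] ℝ) y := by
    have h := ((EuclideanSpace.proj k : EuclideanSpace ℝ (Fin n) →L[ℝ] ℝ).hasFDerivAt
      (x := y)).sub_const (y₀ k)
    exact h
  unfold partialD
  rw [this.fderiv]
  simp

theorem partialD_frozenFlat (i k : Fin n) :
    partialD i (fun z => frozenFlat G y₀ z k) y = G y₀ k i := by
  have hd : ∀ l, DifferentiableAt ℝ (fun z : EuclideanSpace ℝ (Fin n) => (z - y₀).ofLp l) y :=
    fun l => by fun_prop
  simp only [frozenFlat, mulVec, dotProduct]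
  rw [partialD_sum fun l _ => (hd l).const_mul _]
  have : ∀ l, partialD i (fun z => G y₀ k l * (z - y₀).ofLp l) y
      = G y₀ k l * if l = i then 1 else 0 := by
    intro l
    rw [partialD_mul (differentiableAt_const _) (hd l), partialD_const, partialD_coord_sub]
    ring
  simp only [this]
  simp

theorem partialD_frozenSq (hsymm : ∀ i j, G y₀ i j = G y₀ j i) (i : Fin n) :
    partialD i (frozenSq G y₀) y = 2 * frozenFlat G y₀ y i := by
  have hd : ∀ l, DifferentiableAt ℝ (fun z : EuclideanSpace ℝ (Fin n) => (z - y₀).ofLp l) y :=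
    fun l => by fun_prop
  have hf : ∀ l, DifferentiableAt ℝ (fun z => frozenFlat G y₀ z l) y :=
    fun l => ((contDiff_frozenFlat l).differentiable (by simp)).differentiableAt
  have e : frozenSq G y₀ = fun z => ∑ k, (z - y₀).ofLp k * frozenFlat G y₀ z k := rfl
  rw [e, partialD_sum fun l _ => (hd l).fun_mul (hf l)]
  have : ∀ k, partialD i (fun z => (z - y₀).ofLp k * frozenFlat G y₀ z k) y
      = (if k = i then frozenFlat G y₀ y k else 0) + G y₀ i k * (y - y₀).ofLp k := by
    intro k
    rw [partialD_mul (hd k) (hf k), partialD_coord_sub, partialD_frozenFlat, hsymm k i]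
    split_ifs <;> ring
  simp only [this, Finset.sum_add_distrib, Finset.sum_ite_eq', Finset.mem_univ, if_true]
  rw [show ∑ k, G y₀ i k * (y - y₀).ofLp k = frozenFlat G y₀ y i from rfl]
  ring

/-- The Schouten tensor of a conformal metric whose exponent is a function of `frozenSq`. -/
theorem schoutenTensor_radial (hn : 3 ≤ n) (h : IsSmoothMetricOn G V)
    (hsymm : ∀ i j, G y₀ i j = G y₀ j i) (hV : ∀ z ∈ V, 0 < frozenSq G y₀ z)
    {h₀ h₁ : ℝ → ℝ} {h₂ c : ℝ} (hsm : ContDiffOn ℝ ∞ h₀ (Set.Ioi 0))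
    (hd₀ : ∀ t > 0, HasDerivAt h₀ (h₁ t) t) (hd₁ : HasDerivAt h₁ h₂ (frozenSq G y₀ y))
    (hG' : ∀ z ∈ V, G' z = Real.exp (2 * (h₀ (frozenSq G y₀ z) + c)) • G z) (hy : y ∈ V)
    (v : Fin n → ℝ) :
    v ⬝ᵥ schoutenTensor G' y *ᵥ v = v ⬝ᵥ schoutenTensor G y *ᵥ v
      - (4 * h₂ * (frozenFlat G y₀ y ⬝ᵥ v) ^ 2
        + 2 * h₁ (frozenSq G y₀ y) * (v ⬝ᵥ G y₀ *ᵥ v)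
        - 2 * h₁ (frozenSq G y₀ y)
          * (v ⬝ᵥ (Matrix.of fun i j => ∑ l, christoffel G l i j y * frozenFlat G y₀ y l) *ᵥ v))
      + 4 * h₁ (frozenSq G y₀ y) ^ 2 * (frozenFlat G y₀ y ⬝ᵥ v) ^ 2
      - 2 * h₁ (frozenSq G y₀ y) ^ 2
        * (frozenFlat G y₀ y ⬝ᵥ (G y)⁻¹ *ᵥ frozenFlat G y₀ y) * (v ⬝ᵥ G y *ᵥ v) := by
  set F : EuclideanSpace ℝ (Fin n) → ℝ := fun z => h₀ (frozenSq G y₀ z) + c with hFdef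
  have hsq : ∀ z, DifferentiableAt ℝ (frozenSq G y₀) z := fun z =>
    (contDiff_frozenSq.differentiable (by simp)).differentiableAt
  have hfl : ∀ l, DifferentiableAt ℝ (fun z => frozenFlat G y₀ z l) y :=
    fun l => ((contDiff_frozenFlat l).differentiable (by simp)).differentiableAt
  have hF : ContDiffOn ℝ ∞ F V :=
    (hsm.comp contDiff_frozenSq.contDiffOn fun z hz => hV z hz).add contDiffOn_const
  have hF1 : ∀ z ∈ V, ∀ i, partialD i F z
      = 2 * h₁ (frozenSq G y₀ z) * frozenFlat G y₀ z i := by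
    intro z hz i
    rw [partialD_comp (h := fun t => h₀ t + c) ((hd₀ _ (hV z hz)).add_const c) (hsq z),
      partialD_frozenSq hsymm]
    ring
  have hF2 : ∀ i j, partialD j (partialD i F) y
      = 4 * h₂ * (frozenFlat G y₀ y i * frozenFlat G y₀ y j)
        + 2 * h₁ (frozenSq G y₀ y) * G y₀ i j := by
    intro i j
    have hd : DifferentiableAt ℝ (fun z => 2 * h₁ (frozenSq G y₀ z)) y :=
      ((hd₁.comp_hasFDerivAt y (hsq y).hasFDerivAt).differentiableAt).const_mul 2
    rw [partialD_congr h.isOpen (fun z hz => hF1 z hz i) hy, partialD_mul hd (hfl i),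
      partialD_comp (h := fun t => 2 * h₁ t) (hd₁.const_mul 2) (hsq y), partialD_frozenSq hsymm,
      partialD_frozenFlat]
    ring
  have hentry : ∀ i j, schoutenTensor G' y i j = schoutenTensor G y i j
      - (4 * h₂ * (frozenFlat G y₀ y i * frozenFlat G y₀ y j)
        + 2 * h₁ (frozenSq G y₀ y) * G y₀ i j
        - 2 * h₁ (frozenSq G y₀ y) * ∑ l, christoffel G l i j y * frozenFlat G y₀ y l)
      + 4 * h₁ (frozenSq G y₀ y) ^ 2 * (frozenFlat G y₀ y i * frozenFlat G y₀ y j)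
      - 2 * h₁ (frozenSq G y₀ y) ^ 2
        * (frozenFlat G y₀ y ⬝ᵥ (G y)⁻¹ *ᵥ frozenFlat G y₀ y) * G y i j := by
    intro i j
    have e1 : ∑ l, christoffel G l i j y * partialD l F y
        = 2 * h₁ (frozenSq G y₀ y) * ∑ l, christoffel G l i j y * frozenFlat G y₀ y l := by
      rw [Finset.mul_sum]
      exact Finset.sum_congr rfl fun l _ => by rw [hF1 y hy]; ring
    have e2 : ∑ k, partialD k F y * gradD G F k y = 4 * h₁ (frozenSq G y₀ y) ^ 2
        * (frozenFlat G y₀ y ⬝ᵥ (G y)⁻¹ *ᵥ frozenFlat G y₀ y) := by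
      simp only [gradD, hF1 y hy, dotProduct, mulVec, Finset.mul_sum]
      exact Finset.sum_congr rfl fun k _ => Finset.sum_congr rfl fun l _ => by ring
    rw [h.schoutenTensor_conformal hn hF hG' hy, hF2, e1, e2, hF1 y hy, hF1 y hy]
    ring
  have hX : v ⬝ᵥ vecMulVec (frozenFlat G y₀ y) (frozenFlat G y₀ y) *ᵥ v
      = (frozenFlat G y₀ y ⬝ᵥ v) ^ 2 := by
    rw [vecMulVec_mulVec, op_smul_eq_smul, dotProduct_smul, smul_eq_mul, dotProduct_comm v, sq]
  have hmat : schoutenTensor G' y = schoutenTensor G y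
      - ((4 * h₂) • vecMulVec (frozenFlat G y₀ y) (frozenFlat G y₀ y)
        + (2 * h₁ (frozenSq G y₀ y)) • G y₀
        - (2 * h₁ (frozenSq G y₀ y))
          • (Matrix.of fun i j => ∑ l, christoffel G l i j y * frozenFlat G y₀ y l))
      + (4 * h₁ (frozenSq G y₀ y) ^ 2) • vecMulVec (frozenFlat G y₀ y) (frozenFlat G y₀ y)
      - (2 * h₁ (frozenSq G y₀ y) ^ 2
        * (frozenFlat G y₀ y ⬝ᵥ (G y)⁻¹ *ᵥ frozenFlat G y₀ y)) • G y := by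
    ext i j
    simp only [hentry, Matrix.sub_apply, Matrix.add_apply, Matrix.smul_apply, vecMulVec_apply,
      Matrix.of_apply, smul_eq_mul]
  rw [hmat]
  simp only [sub_mulVec, add_mulVec, smul_mulVec, dotProduct_sub, dotProduct_add, dotProduct_smul,
    hX, smul_eq_mul]

end Radial

/-! ### One-variable estimates for the barrier -/

section Barrier

/-- The exponent of the radial barrier, as a function of the squared radius. -/
def barrierExp (κ c ρ : ℝ) : ℝ := (1 / κ) * Real.log (1 + c * ρ ^ (-κ)) - √ρ

/-- The quantity `-2 ρ ∂_ρ` of the barrier exponent. -/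
def barrierSlope (κ c ρ : ℝ) : ℝ := 2 * (c * ρ ^ (-κ)) / (1 + c * ρ ^ (-κ)) + √ρ

variable {κ c : ℝ}

theorem contDiffOn_barrierExp (hc : 0 < c) :
    ContDiffOn ℝ ∞ (barrierExp κ c) (Set.Ioi 0) := by
  intro t ht
  have ht : 0 < t := ht
  have h1 : 1 + c * t ^ (-κ) ≠ 0 := by positivity
  refine ContDiffAt.contDiffWithinAt ?_
  exact (contDiffAt_const.mul ((contDiffAt_const.add (contDiffAt_const.mul
    (Real.contDiffAt_rpow_const_of_ne ht.ne'))).log h1)).sub (Real.contDiffAt_sqrt ht.ne')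

theorem hasDerivAt_barrierExp (hκ : κ ≠ 0) (hc : 0 < c) {t : ℝ} (ht : 0 < t) :
    HasDerivAt (barrierExp κ c) (-(barrierSlope κ c t) / (2 * t)) t := by
  have h1 : 1 + c * t ^ (-κ) ≠ 0 := by positivity
  have hp := (Real.hasDerivAt_rpow_const (p := -κ) (Or.inl ht.ne')).const_mul c
  have := (((hp.const_add 1).log h1).const_mul (1 / κ)).sub (Real.hasDerivAt_sqrt ht.ne')
  refine this.congr_deriv ?_
  rw [Real.rpow_sub_one ht.ne']
  unfold barrierSlope
  have hs : √t ≠ 0 := (Real.sqrt_pos.2 ht).ne'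
  have e : t = √t ^ 2 := (Real.sq_sqrt ht.le).symm
  generalize t ^ (-κ) = q at *
  generalize √t = s at *
  subst e
  field_simp
  ring

theorem hasDerivAt_barrierExp_deriv (hc : 0 < c) {t : ℝ} (ht : 0 < t) :
    HasDerivAt (fun t => -(barrierSlope κ c t) / (2 * t))
      ((2 * barrierSlope κ c t - (√t - 2 * κ * (2 * (c * t ^ (-κ)) / (1 + c * t ^ (-κ)) ^ 2)))
        / (4 * t ^ 2)) t := by
  have h1 : 1 + c * t ^ (-κ) ≠ 0 := by positivity
  have hp := (Real.hasDerivAt_rpow_const (p := -κ) (Or.inl ht.ne')).const_mul c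
  have h2 := ((hp.const_mul 2).div (hp.const_add 1) h1).add (Real.hasDerivAt_sqrt ht.ne')
  have := h2.neg.div ((hasDerivAt_id t).const_mul 2) (by simpa using ht.ne')
  refine this.congr_deriv ?_
  simp only [Real.rpow_sub_one ht.ne', Pi.add_apply, Pi.neg_apply, Pi.div_apply, id]
  unfold barrierSlope
  have hs : √t ≠ 0 := (Real.sqrt_pos.2 ht).ne'
  have e : t = √t ^ 2 := (Real.sq_sqrt ht.le).symm
  generalize t ^ (-κ) = q at *
  generalize √t = s at *
  subst e
  field_simp
  ring

/-- Used with q = c ρ^(-κ), p = ρ^(1/4) and a the slope; p⁴ + a p² is the error of the curved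
background times ρ. The bounds do not involve c, so they are uniform over the family of barriers. -/
theorem barrier_scalar {q p a : ℝ} (hq : 0 < q) (hp : 0 < p) (hp1 : p ≤ 1 / 32) (hqp : q * p ≤ 1)
    (ha : a = 2 * q / (1 + q) + p ^ 2) :
    0 < a ∧ a ≤ 4 ∧ 0 < a - a ^ 2 / 2 ∧ 2 * q / (1 + q) ^ 2 ≤ 2 * (a - a ^ 2 / 2) ∧
      p ^ 4 + a * p ^ 2 ≤ 64 * p * (a - a ^ 2 / 2) := by
  set A := 2 * q / (1 + q) with hA
  set σ := 2 * q / (1 + q) ^ 2 with hσ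
  have hA0 : 0 < A := by positivity
  have hσ0 : 0 < σ := by positivity
  have hA2 : A ≤ 2 := by
    rw [hA, div_le_iff₀ (by positivity)]; linarith
  have hp2 : 0 < p ^ 2 := by positivity
  have hp21 : p ^ 2 ≤ p / 32 := by nlinarith
  have ha0 : 0 < a := by rw [ha]; positivity
  have ha4 : a ≤ 3 := by rw [ha]; linarith
  have ht : a - a ^ 2 / 2 = σ + (1 - A) * p ^ 2 - p ^ 4 / 2 := by
    rw [ha, hA, hσ]
    field_simp
    ring
  have hp4 : p ^ 4 ≤ p ^ 2 / 4 := by nlinarith [mul_nonneg hp2.le hp2.le]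
  -- For q ≤ 1/3, a - a²/2 ≥ a/4, and the correction √ρ in the slope gives a ≥ p², so the error is
  -- at most 2ap². For q ≥ 1/3, a - a²/2 is at least about 1/q; `hqp` makes this at least p/16,
  -- while the error is O(p²).
  rcases le_total q (1 / 3) with h | h
  · have hA1 : A ≤ 1 / 2 := by
      rw [hA, div_le_iff₀ (by positivity)]; linarith
    have hσA : A / 4 ≤ σ := by
      have : σ = A / (1 + q) := by rw [hA, hσ]; field_simp
      rw [this]
      gcongr
      linarith
    have h4 : a / 4 ≤ a - a ^ 2 / 2 := by
      rw [ht]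
      have : p ^ 2 / 2 ≤ (1 - A) * p ^ 2 := by nlinarith
      rw [ha]
      linarith
    have h5 : σ ≤ 2 * (a - a ^ 2 / 2) := by
      rw [ht]
      have : p ^ 2 / 2 ≤ (1 - A) * p ^ 2 := by nlinarith
      linarith
    refine ⟨ha0, by linarith, by linarith, h5, ?_⟩
    have h6 : p ^ 2 ≤ a := by rw [ha]; linarith
    have h7 : p ^ 4 + a * p ^ 2 ≤ 2 * a * p ^ 2 := by nlinarith
    have h8 : 2 * a * p ^ 2 ≤ 2 * a * (p / 32) := by gcongr
    have h9 : 64 * p * (a / 4) ≤ 64 * p * (a - a ^ 2 / 2) := by gcongr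
    nlinarith [mul_pos ha0 hp]
  · have hσp : p / 8 ≤ σ := by
      have h1 : 1 / (8 * q) ≤ σ := by
        rw [hσ, div_le_div_iff₀ (by positivity) (by positivity)]
        nlinarith
      refine le_trans ?_ h1
      rw [div_le_div_iff₀ (by norm_num) (by positivity)]
      linarith
    have h2 : σ / 2 ≤ a - a ^ 2 / 2 := by
      rw [ht]
      have : -(p ^ 2) ≤ (1 - A) * p ^ 2 := by nlinarith
      nlinarith
    refine ⟨ha0, by linarith, by linarith, by linarith, ?_⟩
    have h3 : p ^ 4 + a * p ^ 2 ≤ 4 * p ^ 2 := by nlinarith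
    have h4 : 64 * p * (p / 16) ≤ 64 * p * (a - a ^ 2 / 2) := by
      gcongr
      linarith
    linarith

end Barrier

/-! ### Eigenvalues of the barrier metrics -/

section BarrierSpectrum

open Matrix

variable {n : ℕ}

theorem frozenSq_self {G : EuclideanSpace ℝ (Fin n) → Matrix (Fin n) (Fin n) ℝ}
    {y₀ : EuclideanSpace ℝ (Fin n)} : frozenSq G y₀ y₀ = 0 := by
  simp [frozenSq]

/-- The right side is the formula of `schoutenTensor_radial` at ρ = p⁴. The numbers `g`, `g₀`, `S`,
`B` stand for the forms of the metric, frozen metric, Schouten tensor and Christoffel term on one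
vector; `Z` is the dual norm squared of the radial covector and `X` its squared value on the vector.
All errors are absorbed into the factor 1 - η. -/
theorem barrier_form_ge {a t b C p η κ g g₀ S B Z X : ℝ} (hp : 0 < p) (hC : 0 < C)
    (ht : t = a - a ^ 2 / 2) (ha : 0 < a) (ha4 : a ≤ 4) (hb : -b ≤ 4 * κ * t)
    (herr : 4 * C * (p ^ 4 + a * p ^ 2) ≤ η * t)
    (hg : 0 ≤ g) (hX : 0 ≤ X) (hS : -(C * g) ≤ S) (hg₀ : (1 - C * p ^ 2) * g ≤ g₀)
    (hB : B ≤ C * p ^ 2 * g) (hZ : Z ≤ (1 + C * p ^ 2) * p ^ 4) :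
    t * (1 - η) / p ^ 4 * g - t * (2 + 4 * κ) / (p ^ 4) ^ 2 * X
      ≤ S - (4 * ((2 * a - b) / (4 * (p ^ 4) ^ 2)) * X + 2 * (-a / (2 * p ^ 4)) * g₀
          - 2 * (-a / (2 * p ^ 4)) * B)
        + 4 * (-a / (2 * p ^ 4)) ^ 2 * X - 2 * (-a / (2 * p ^ 4)) ^ 2 * Z * g := by
  have e0 : S - (4 * ((2 * a - b) / (4 * (p ^ 4) ^ 2)) * X + 2 * (-a / (2 * p ^ 4)) * g₀
          - 2 * (-a / (2 * p ^ 4)) * B)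
        + 4 * (-a / (2 * p ^ 4)) ^ 2 * X - 2 * (-a / (2 * p ^ 4)) ^ 2 * Z * g
      = S + a / p ^ 4 * g₀ - a / p ^ 4 * B - a ^ 2 / (2 * (p ^ 4) ^ 2) * (Z * g)
        - (2 * t - b) / (p ^ 4) ^ 2 * X := by
    rw [ht]
    field_simp
    ring
  have e1 : a / p ^ 4 * ((1 - C * p ^ 2) * g) ≤ a / p ^ 4 * g₀ := by gcongr
  have e2 : a / p ^ 4 * B ≤ a / p ^ 4 * (C * p ^ 2 * g) := by gcongr
  have e3 : a ^ 2 / (2 * (p ^ 4) ^ 2) * (Z * g)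
      ≤ a ^ 2 / (2 * (p ^ 4) ^ 2) * ((1 + C * p ^ 2) * p ^ 4 * g) := by gcongr
  have e4 : (2 * t - b) / (p ^ 4) ^ 2 * X ≤ t * (2 + 4 * κ) / (p ^ 4) ^ 2 * X := by
    gcongr
    linarith
  have e5 : t * (1 - η) ≤ -(C * p ^ 4) + a * (1 - C * p ^ 2) - a * (C * p ^ 2)
      - a ^ 2 / 2 * (1 + C * p ^ 2) := by
    have h1 : a ^ 2 / 2 * (C * p ^ 2) ≤ 2 * a * (C * p ^ 2) := by
      gcongr
      nlinarith
    have h2 : 0 ≤ C * p ^ 4 := by positivity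
    nlinarith
  have e6 : t * (1 - η) / p ^ 4 * g ≤ (-(C * p ^ 4) + a * (1 - C * p ^ 2) - a * (C * p ^ 2)
      - a ^ 2 / 2 * (1 + C * p ^ 2)) / p ^ 4 * g := by gcongr
  have e7 : (-(C * p ^ 4) + a * (1 - C * p ^ 2) - a * (C * p ^ 2)
      - a ^ 2 / 2 * (1 + C * p ^ 2)) / p ^ 4 * g
      = -(C * g) + a / p ^ 4 * ((1 - C * p ^ 2) * g) - a / p ^ 4 * (C * p ^ 2 * g)
        - a ^ 2 / (2 * (p ^ 4) ^ 2) * ((1 + C * p ^ 2) * p ^ 4 * g) := by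
    field_simp
  rw [e0]
  linarith

/-- Near `y₀`, all the Schouten eigenvalues of the barrier metrics lie in the cone `Γ`. -/
theorem exists_barrier_mem_cone {Γ : Set (Fin n → ℝ)} (hn : 3 ≤ n) (hΓ : IsAdmissibleCone Γ)
    (hμ : 1 < muPlus Γ) {U : Set (EuclideanSpace ℝ (Fin n))} {y₀ : EuclideanSpace ℝ (Fin n)}
    {G : EuclideanSpace ℝ (Fin n) → Matrix (Fin n) (Fin n) ℝ} (h : IsSmoothMetricOn G U)
    (hpos : ∀ v : Fin n → ℝ, v ≠ 0 → 0 < v ⬝ᵥ G y₀ *ᵥ v) (hy₀ : y₀ ∈ U) :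
    ∃ κ > 0, ∃ m > 0, (∀ y, m * ‖y - y₀‖ ^ 2 ≤ frozenSq G y₀ y) ∧ ∀ᶠ y in 𝓝 y₀, y ≠ y₀ →
      ∀ c : ℝ, 0 < c → c ≤ 1 → ∀ (c₀ : ℝ)
        (G' : EuclideanSpace ℝ (Fin n) → Matrix (Fin n) (Fin n) ℝ),
        (∀ᶠ z in 𝓝 y, G' z = Real.exp (2 * (barrierExp κ c (frozenSq G y₀ z) + c₀)) • G z) →
        ∀ lam : Fin n → ℝ, IsEigenvalueTuple (schoutenTensor G' y) (G' y) lam → lam ∈ Γ := by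
  -- Any μ strictly between 1 and `muPlus Γ` would do; d measures the room for κ and the errors.
  set μ : ℝ := (1 + muPlus Γ) / 2 with hμdef
  set d : ℝ := μ - 1 with hd
  have hd0 : 0 < d := by rw [hd, hμdef]; linarith
  -- κ ≤ d/8 gives 2 + 4κ ≤ 2 + d/2, and κ ≤ 1/4 gives c ρ^(-κ) ≤ ρ^(-1/4).
  set κ : ℝ := min (d / 8) (1 / 4) with hκdef
  have hκ0 : 0 < κ := lt_min (by positivity) (by norm_num)
  have hκd : κ ≤ d / 8 := min_le_left _ _
  have hκ4 : κ ≤ 1 / 4 := min_le_right _ _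
  -- The solution of (2 + d/2)(1 + η) = (1 - η)(2 + d), with 2 + d = 1 + μ.
  set η : ℝ := d / (8 + 3 * d) with hη
  have hη0 : 0 < η := by positivity
  have hηd : η * (8 + 3 * d) = d := by rw [hη]; field_simp
  have hη1 : η < 1 := by rw [hη, div_lt_one (by positivity)]; linarith
  clear_value μ d κ η
  obtain ⟨m, hm, C, hC, hmz, hbounds⟩ := h.exists_local_bounds hpos hy₀
  refine ⟨κ, hκ0, m, hm, hmz, ?_⟩
  have hcont : Continuous (frozenSq G y₀) := contDiff_frozenSq.continuous
  have hpc : ContinuousAt (fun y => (frozenSq G y₀ y) ^ (1 / 4 : ℝ)) y₀ :=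
    hcont.continuousAt.rpow_const (Or.inr (by norm_num))
  -- 256 = 4 · 64: the factor 4C of the error in `barrier_form_ge` times the constant 64 of
  -- `barrier_scalar`.
  set P : ℝ := min (1 / 32) (η / (256 * C)) with hP
  have hP0 : 0 < P := lt_min (by norm_num) (by positivity)
  have hsmall : ∀ᶠ y in 𝓝 y₀, (frozenSq G y₀ y) ^ (1 / 4 : ℝ) ≤ P := by
    have h0 : (frozenSq G y₀ y₀) ^ (1 / 4 : ℝ) < P := by
      rw [frozenSq_self, Real.zero_rpow (by norm_num)]
      exact hP0
    exact (hpc.eventually_lt continuousAt_const h0).mono fun y hy => hy.le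
  filter_upwards [hbounds, hsmall, h.isOpen.mem_nhds hy₀] with y hby hpP hyU hne c hc0 hc1 c₀ G'
    hG' lam hlam
  have hρ : 0 < frozenSq G y₀ y := lt_of_lt_of_le
    (mul_pos hm (pow_pos (norm_pos_iff.2 (sub_ne_zero.2 hne)) 2)) (hmz y)
  obtain ⟨V, hVsub, hVo, hyV⟩ := mem_nhds_iff.1 (Filter.inter_mem (Filter.inter_mem hG'
    (h.isOpen.mem_nhds hyU)) ((isOpen_lt continuous_const hcont).mem_nhds hρ))
  have hV : IsSmoothMetricOn G V := h.mono hVo fun z hz => (hVsub hz).1.2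
  obtain ⟨hZ, hv⟩ := hby
  set ρ := frozenSq G y₀ y with hρdef
  set p := ρ ^ (1 / 4 : ℝ) with hp
  have hp0 : 0 < p := Real.rpow_pos_of_pos hρ _
  have hp4 : p ^ 4 = ρ := by
    rw [hp, ← Real.rpow_natCast, ← Real.rpow_mul hρ.le]
    norm_num
  have hsqrt : √ρ = p ^ 2 := by
    rw [← hp4, show p ^ 4 = (p ^ 2) ^ 2 by ring, Real.sqrt_sq (by positivity)]
  have hp32 : p ≤ 1 / 32 := hpP.trans (min_le_left _ _)
  have hpη : 256 * C * p ≤ η := by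
    have := hpP.trans (min_le_right _ _)
    rw [le_div_iff₀ (by positivity)] at this
    linarith
  set q := c * ρ ^ (-κ) with hq
  have hq0 : 0 < q := by positivity
  have hρ1 : ρ ≤ 1 := by
    rw [← hp4]
    exact pow_le_one₀ hp0.le (by linarith)
  have hqp : q * p ≤ 1 := by
    have h1 : ρ ^ (-κ) ≤ ρ ^ (-(1 / 4) : ℝ) :=
      Real.rpow_le_rpow_of_exponent_ge hρ hρ1 (by linarith)
    have h2 : ρ ^ (-(1 / 4) : ℝ) * p = 1 := by
      rw [hp, ← Real.rpow_add hρ]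
      norm_num
    calc q * p ≤ 1 * ρ ^ (-(1 / 4) : ℝ) * p := by rw [hq]; gcongr
      _ = 1 := by rw [one_mul, h2]
  have hslope : barrierSlope κ c ρ = 2 * q / (1 + q) + p ^ 2 := by
    unfold barrierSlope
    rw [hsqrt]
  obtain ⟨ha0, ha4, ht0, hσ, herr⟩ := barrier_scalar hq0 hp0 hp32 hqp hslope
  set a := barrierSlope κ c ρ with ha
  obtain ⟨t, ht⟩ : ∃ t, t = a - a ^ 2 / 2 := ⟨_, rfl⟩
  rw [← ht] at ht0 hσ herr
  have hrad := fun v => schoutenTensor_radial hn hV (h.symm y₀ hy₀) (fun z hz => (hVsub hz).2)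
    (contDiffOn_barrierExp (κ := κ) hc0) (fun t ht => hasDerivAt_barrierExp hκ0.ne' hc0 ht)
    (hasDerivAt_barrierExp_deriv hc0 hρ) (fun z hz => (hVsub hz).1.1) hyV v
  rw [hG'.self_of_nhds] at hlam
  clear_value a q p P ρ
  -- The rank-one weight is chosen so that its product with T(1 + μ) is the coefficient t(2 + 4κ)/ρ²
  -- of `barrier_form_ge`.
  refine hlam.mem_cone hΓ (by omega) (μ := μ) (by linarith) (by rw [hμdef]; linarith)
    (T := t * (1 - η) / ρ) (κ := (2 + 4 * κ) / ((1 - η) * (1 + μ) * ρ)) (Real.exp_pos _) ?_ ?_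
    (frozenFlat G y₀ y) ?_ ?_
  · exact div_pos (mul_pos ht0 (by linarith)) hρ
  · have : 0 < 1 - η := by linarith
    have : 0 < 1 + μ := by linarith
    positivity
  · have h1 : 0 < (1 - η) * (1 + μ) := mul_pos (by linarith) (by linarith)
    rw [div_mul_eq_mul_div, div_le_one (mul_pos h1 hρ)]
    have hx : C * √ρ ≤ η := by
      rw [hsqrt]
      nlinarith [mul_pos hC hp0]
    calc (2 + 4 * κ) * (frozenFlat G y₀ y ⬝ᵥ (G y)⁻¹ *ᵥ frozenFlat G y₀ y)
        ≤ (2 + 4 * κ) * ((1 + C * √ρ) * ρ) := by gcongr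
      _ ≤ (2 + d / 2) * ((1 + η) * ρ) := by
          gcongr
          linarith
      _ = ((2 + d / 2) * (1 + η)) * ρ := by ring
      _ ≤ (1 - η) * (1 + μ) * ρ := by
          refine mul_le_mul_of_nonneg_right ?_ hρ.le
          have : 1 + μ = 2 + d := by rw [hd]; ring
          rw [this]
          nlinarith
  · intro v
    obtain ⟨hg, hS, hg₀, hB⟩ := hv v
    rw [hrad v, ← hρdef, ← ha, ← hq, hsqrt, ← hp4]
    rw [hsqrt] at hg₀ hB hZ
    rw [← hp4] at hZ
    generalize 2 * q / (1 + q) ^ 2 = σ at hσ ⊢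
    have hmain := barrier_form_ge (b := p ^ 2 - 2 * κ * σ) (κ := κ) (η := η)
      (X := (frozenFlat G y₀ y ⬝ᵥ v) ^ 2) hp0 hC ht ha0 ha4
      (by linarith [mul_le_mul_of_nonneg_left hσ hκ0.le, sq_nonneg p])
      (by
        have h1 := mul_le_mul_of_nonneg_left herr (mul_pos four_pos hC).le
        have h2 := mul_le_mul_of_nonneg_right hpη ht0.le
        linarith)
      hg (sq_nonneg _) hS hg₀ hB hZ
    refine le_trans (le_of_eq ?_) hmain
    have h1 : 1 - η ≠ 0 := by linarith
    have h2 : 1 + μ ≠ 0 := by linarith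
    field_simp

end BarrierSpectrum

/-! ### Comparison on a punctured ball -/

section Comparison

/-- A comparison principle on a punctured ball: an upper semicontinuous function which lies below
`A • Φ` near the boundary and is nowhere touched from above by a larger multiple of `Φ` lies below
`A • Φ`. -/
theorem le_mul_of_forall_not_touching {E : Type*} [NormedAddCommGroup E] [ProperSpace E]
    {y₀ : E} {R A : ℝ} {w Φ : E → ℝ}
    (hw : UpperSemicontinuousOn w (Metric.closedBall y₀ R \ {y₀}))
    (hΦ : ContinuousOn Φ (Metric.closedBall y₀ R \ {y₀}))
    (hpos : ∀ y ∈ Metric.closedBall y₀ R \ {y₀}, 0 < Φ y)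
    (hsphere : ∀ y ∈ Metric.sphere y₀ R, w y ≤ A * Φ y)
    (hnear : ∀ᶠ y in 𝓝[≠] y₀, w y ≤ A * Φ y)
    (htouch : ∀ y ∈ Metric.ball y₀ R, y ≠ y₀ → ∀ t > A, w y = t * Φ y →
      ¬ ∀ᶠ z in 𝓝 y, w z ≤ t * Φ z) :
    ∀ y ∈ Metric.closedBall y₀ R, y ≠ y₀ → w y ≤ A * Φ y := by
  intro y₁ hy₁ hne
  by_contra! hlt
  obtain ⟨r, hr, hball⟩ := Metric.mem_nhds_iff.1 (mem_nhdsWithin_iff_eventually.1 hnear)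
  have hin : ∀ y ∈ Metric.ball y₀ r, y ≠ y₀ → w y ≤ A * Φ y := fun y hy h => hball hy h
  -- Violations of the bound occur only at distance at least r from the centre. Removing just the
  -- ball of radius r/2 keeps a maximum point of w/Φ off the inner boundary, so it is a genuine
  -- touching point.
  set S := Metric.closedBall y₀ R \ Metric.ball y₀ (r / 2) with hS
  have hScomp : IsCompact S := (isCompact_closedBall y₀ R).diff Metric.isOpen_ball
  have hsub : S ⊆ Metric.closedBall y₀ R \ {y₀} := by
    refine fun y hy => ⟨hy.1, fun h => hy.2 ?_⟩
    rw [Set.mem_singleton_iff.1 h]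
    exact Metric.mem_ball_self (by linarith)
  have hmemS : ∀ y ∈ Metric.closedBall y₀ R, y ≠ y₀ → A * Φ y < w y → y ∈ S ∧ r ≤ dist y y₀ := by
    intro y hy h hy'
    have : r ≤ dist y y₀ := by
      by_contra! hd
      exact absurd (hin y hd h) (not_le.2 hy')
    refine ⟨⟨hy, fun hb => ?_⟩, this⟩
    rw [Metric.mem_ball] at hb
    linarith
  have husc : UpperSemicontinuousOn (fun y => w y / Φ y) S := by
    intro y hy b hb
    have hΦy := hpos y (hsub hy)
    rw [div_lt_iff₀ hΦy] at hb
    obtain ⟨b', h1, h2⟩ := exists_between hb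
    have e1 := (hw.mono hsub) y hy b' h1
    have e2 : ∀ᶠ z in 𝓝[S] y, b' < b * Φ z :=
      ((hΦ.mono hsub y hy).const_mul b).eventually (lt_mem_nhds h2)
    filter_upwards [e1, e2, self_mem_nhdsWithin] with z hz1 hz2 hzS
    rw [div_lt_iff₀ (hpos z (hsub hzS))]
    exact hz1.trans hz2
  obtain ⟨y, hyS, hmax⟩ := husc.exists_isMaxOn ⟨y₁, (hmemS y₁ hy₁ hne hlt).1⟩ hScomp
  have hΦy := hpos y (hsub hyS)
  have htA : A < w y / Φ y := by
    refine lt_of_lt_of_le ?_ (hmax (hmemS y₁ hy₁ hne hlt).1)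
    rwa [lt_div_iff₀ (hpos y₁ ⟨hy₁, hne⟩)]
  have hwy : w y = w y / Φ y * Φ y := by field_simp
  have hyne : y ≠ y₀ := (hsub hyS).2
  have hAw : A * Φ y < w y := by rwa [lt_div_iff₀ hΦy] at htA
  have hyball : y ∈ Metric.ball y₀ R := by
    refine Metric.mem_ball.2 (lt_of_le_of_ne (Metric.mem_closedBall.1 hyS.1) fun h => ?_)
    exact absurd (hsphere y h) (not_le.2 hAw)
  refine htouch y hyball hyne _ htA hwy ?_
  have hd : r / 2 < dist y y₀ := by
    have := (hmemS y hyS.1 hyne hAw).2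
    linarith
  have hopen : ∀ᶠ z in 𝓝 y, r / 2 < dist z y₀ :=
    continuousAt_const.eventually_lt (by fun_prop : ContinuousAt (fun z => dist z y₀) y) hd
  filter_upwards [Metric.isOpen_ball.mem_nhds hyball, hopen] with z hz hz'
  have hzS : z ∈ S := ⟨Metric.ball_subset_closedBall hz, fun hb => by
    rw [Metric.mem_ball] at hb
    linarith⟩
  have := hmax hzS
  rwa [Set.mem_ofPred_eq, div_le_iff₀ (hpos z (hsub hzS))] at this

end Comparison

/-! ### Bounds on the barrier: boundary, centre, and small c -/

section BarrierBounds

variable {κ c ρ : ℝ}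

theorem neg_sqrt_le_barrierExp (hκ : 0 < κ) (hc : 0 ≤ c) (hρ : 0 ≤ ρ) :
    -√ρ ≤ barrierExp κ c ρ := by
  have h1 : 0 ≤ c * ρ ^ (-κ) := mul_nonneg hc (Real.rpow_nonneg hρ _)
  have h2 : 0 ≤ (1 / κ) * Real.log (1 + c * ρ ^ (-κ)) :=
    mul_nonneg (by positivity) (Real.log_nonneg (by linarith))
  unfold barrierExp
  linarith

/-- The factor 1/κ turns ρ^(-κ) into -log ρ, so for every c > 0 the conformal factor has the
critical blow-up rate r^(2-n). -/
theorem log_le_barrierExp (hκ : 0 < κ) (hc : 0 < c) (hρ : 0 < ρ) :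
    (1 / κ) * Real.log c - Real.log ρ - √ρ ≤ barrierExp κ c ρ := by
  have hq : 0 < c * ρ ^ (-κ) := by positivity
  have h1 : Real.log (c * ρ ^ (-κ)) ≤ Real.log (1 + c * ρ ^ (-κ)) :=
    Real.log_le_log hq (by linarith)
  rw [Real.log_mul hc.ne' (by positivity), Real.log_rpow hρ] at h1
  have h2 : (1 / κ) * (Real.log c + -κ * Real.log ρ)
      ≤ (1 / κ) * Real.log (1 + c * ρ ^ (-κ)) := by gcongr
  have h3 : (1 / κ) * (Real.log c + -κ * Real.log ρ) = (1 / κ) * Real.log c - Real.log ρ := by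
    field_simp
    ring
  unfold barrierExp
  linarith

theorem barrierExp_le (hκ : 0 < κ) (hc : 0 ≤ c) (hρ : 0 < ρ) (hcρ : c ≤ ρ ^ κ) :
    barrierExp κ c ρ ≤ (1 / κ) * Real.log 2 := by
  have hq : 0 ≤ c * ρ ^ (-κ) := by positivity
  have h1 : c * ρ ^ (-κ) ≤ 1 := by
    rw [Real.rpow_neg hρ.le, ← div_eq_mul_inv, div_le_one (by positivity)]
    exact hcρ
  have h2 : (1 / κ) * Real.log (1 + c * ρ ^ (-κ)) ≤ (1 / κ) * Real.log 2 := by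
    gcongr
    linarith
  unfold barrierExp
  linarith [Real.sqrt_nonneg ρ]

end BarrierBounds

/-! ### The chart estimate in terms of `dist` -/

section ChartDistance

attribute [local instance 2000] chartedSpaceSelf

theorem eventually_norm_chartAt_sub_le {n : ℕ} {M : Type*} [MetricSpace M]
    [ChartedSpace (EuclideanSpace ℝ (Fin n)) M] [IsManifold (𝓡 n) ∞ M]
    [RiemannianBundle (fun x : M => TangentSpace (𝓡 n) x)]
    [IsContMDiffRiemannianBundle (𝓡 n) ∞ (EuclideanSpace ℝ (Fin n))
      (fun x : M => TangentSpace (𝓡 n) x)]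
    [IsRiemannianManifold (𝓡 n) M] (p₀ : M) :
    ∃ L > 0, ∀ᶠ x in 𝓝 p₀,
      ‖chartAt (EuclideanSpace ℝ (Fin n)) p₀ x - chartAt (EuclideanSpace ℝ (Fin n)) p₀ p₀‖
        ≤ L * dist x p₀ := by
  have : IsManifold (𝓡 n) 1 M := IsManifold.of_le (n := ∞) (by exact_mod_cast le_top)
  have : IsContinuousRiemannianBundle (EuclideanSpace ℝ (Fin n))
      (fun x : M => TangentSpace (𝓡 n) x) := by
    obtain ⟨g, hg, hg'⟩ := IsContMDiffRiemannianBundle.exists_contMDiff (IB := 𝓡 n) (n := ∞)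
      (F := EuclideanSpace ℝ (Fin n)) (E := fun x : M => TangentSpace (𝓡 n) x)
    exact ⟨g, hg.continuous, hg'⟩
  obtain ⟨L, hL, hb⟩ := eventually_edist_extChartAt_le (n := n) p₀
  refine ⟨L, hL, hb.mono fun x hx => ?_⟩
  rw [← IsRiemannianManifold.out, edist_dist, edist_dist,
    ← ENNReal.ofReal_coe_nnreal, ← ENNReal.ofReal_mul (by positivity),
    ENNReal.ofReal_le_ofReal_iff (by positivity), dist_comm, dist_comm p₀, dist_eq_norm] at hx
  simpa using hx

end ChartDistance

/-! ### Barriers on the manifold and the conclusion -/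

section Main

attribute [local instance 2000] chartedSpaceSelf

variable {n : ℕ} {M : Type*} [MetricSpace M] [ChartedSpace (EuclideanSpace ℝ (Fin n)) M]
  [RiemannianBundle (fun x : M => TangentSpace (𝓡 n) x)]

/-- The barrier, as a conformal factor: its exponent is `barrierExp` of the squared radius. -/
def barrierFun (G : EuclideanSpace ℝ (Fin n) → Matrix (Fin n) (Fin n) ℝ)
    (y₀ : EuclideanSpace ℝ (Fin n)) (κ c : ℝ) (y : EuclideanSpace ℝ (Fin n)) : ℝ :=
  Real.exp (((n : ℝ) - 2) / 2 * barrierExp κ c (frozenSq G y₀ y))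

theorem contDiffAt_barrierFun {G : EuclideanSpace ℝ (Fin n) → Matrix (Fin n) (Fin n) ℝ}
    {y₀ y : EuclideanSpace ℝ (Fin n)} {κ c : ℝ} (hc : 0 < c) (hy : 0 < frozenSq G y₀ y) :
    ContDiffAt ℝ ∞ (barrierFun G y₀ κ c) y := by
  have h1 : ContDiffAt ℝ ∞ (barrierExp κ c) (frozenSq G y₀ y) :=
    (contDiffOn_barrierExp hc).contDiffAt (Ioi_mem_nhds hy)
  exact (contDiffAt_const.mul (h1.comp y contDiff_frozenSq.contDiffAt)).exp

theorem exists_frozenSq_le (G : EuclideanSpace ℝ (Fin n) → Matrix (Fin n) (Fin n) ℝ)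
    (y₀ : EuclideanSpace ℝ (Fin n)) : ∃ K > 0, ∀ y, frozenSq G y₀ y ≤ K * ‖y - y₀‖ ^ 2 := by
  refine ⟨n ^ 2 * (∑ i, ∑ j, |G y₀ i j|) + 1, by positivity, fun y => ?_⟩
  have hent : ∀ i j, |G y₀ i j| ≤ ∑ i, ∑ j, |G y₀ i j| := fun i j =>
    (Finset.single_le_sum (f := fun j => |G y₀ i j|) (fun _ _ => abs_nonneg _)
      (Finset.mem_univ j)).trans
    (Finset.single_le_sum (f := fun i => ∑ j, |G y₀ i j|)
      (fun _ _ => Finset.sum_nonneg fun _ _ => abs_nonneg _) (Finset.mem_univ i))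
  have h1 := (le_abs_self _).trans (abs_quadratic_le hent (y - y₀).ofLp)
  have h2 : ‖(WithLp.toLp 2 (y - y₀).ofLp : EuclideanSpace ℝ (Fin n))‖ = ‖y - y₀‖ := rfl
  rw [h2] at h1
  unfold frozenSq
  nlinarith [sq_nonneg ‖y - y₀‖]

/-- Here `d` is the Riemannian distance to p₀, so the blow-up of the barrier is expressed in the
quantity of the decay hypothesis. -/
theorem le_barrierFun {G : EuclideanSpace ℝ (Fin n) → Matrix (Fin n) (Fin n) ℝ}
    {y₀ y : EuclideanSpace ℝ (Fin n)} {κ c K d Q : ℝ} (hn : 2 ≤ n) (hκ : 0 < κ) (hc : 0 < c)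
    (hρ : 0 < frozenSq G y₀ y) (hK : 0 < K) (hd : 0 < d) (hρK : frozenSq G y₀ y ≤ K * d ^ 2)
    (hQ : √(frozenSq G y₀ y) ≤ Q) :
    Real.exp (((n : ℝ) - 2) / 2 * (1 / κ * Real.log c - Real.log K - Q)) * (d ^ (n - 2))⁻¹
      ≤ barrierFun G y₀ κ c y := by
  have hn' : (0 : ℝ) ≤ (n : ℝ) - 2 := by
    have : (2 : ℝ) ≤ n := by exact_mod_cast hn
    linarith
  have h1 := log_le_barrierExp hκ hc hρ
  have h2 : Real.log (frozenSq G y₀ y) ≤ Real.log K + 2 * Real.log d := by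
    refine (Real.log_le_log hρ hρK).trans (le_of_eq ?_)
    rw [Real.log_mul hK.ne' (by positivity), Real.log_pow]
    norm_num
  have h3 : (d ^ (n - 2))⁻¹ = Real.exp (-(((n : ℝ) - 2) * Real.log d)) := by
    rw [Real.exp_neg, mul_comm, Real.exp_mul, Real.exp_log hd, ← Real.rpow_natCast,
      Nat.cast_sub hn, Nat.cast_ofNat]
  rw [h3, ← Real.exp_add]
  refine Real.exp_le_exp.2 ?_
  calc ((n : ℝ) - 2) / 2 * (1 / κ * Real.log c - Real.log K - Q) + -(((n : ℝ) - 2) * Real.log d)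
      = ((n : ℝ) - 2) / 2 * (1 / κ * Real.log c - (Real.log K + 2 * Real.log d) - Q) := by ring
    _ ≤ ((n : ℝ) - 2) / 2 * barrierExp κ c (frozenSq G y₀ y) := by
        gcongr
        linarith

/-- A viscosity solution is not touched from above by multiples of the barriers near `p₀`. -/
theorem not_eventually_le_barrierFun (hn : 3 ≤ n) {Γ : Set (Fin n → ℝ)} {u : M → ℝ} {D : Set M}
    (hvisc : IsViscositySolution Γ u D) {e : OpenPartialHomeomorph M (EuclideanSpace ℝ (Fin n))}
    (he : e ∈ IsManifold.maximalAtlas (𝓡 n) ∞ M) {y₀ y : EuclideanSpace ℝ (Fin n)} {κ c t : ℝ}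
    (hc : 0 < c) (ht : 0 < t) (hy : y ∈ e.target) (hyD : e.symm y ∈ D)
    (hρ : 0 < frozenSq (metricInChart e) y₀ y)
    (hcone : ∀ (c₀ : ℝ) (G' : EuclideanSpace ℝ (Fin n) → Matrix (Fin n) (Fin n) ℝ),
      (∀ᶠ z in 𝓝 y, G' z = Real.exp (2 * (barrierExp κ c (frozenSq (metricInChart e) y₀ z) + c₀))
        • metricInChart e z) →
      ∀ lam : Fin n → ℝ, IsEigenvalueTuple (schoutenTensor G' y) (G' y) lam → lam ∈ Γ)
    (heq : u (e.symm y) = t * barrierFun (metricInChart e) y₀ κ c y) :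
    ¬ ∀ᶠ z in 𝓝 y, u (e.symm z) ≤ t * barrierFun (metricInChart e) y₀ κ c z := by
  intro hle
  have hn' : (0 : ℝ) < (n : ℝ) - 2 := by
    have : (3 : ℝ) ≤ n := by exact_mod_cast hn
    linarith
  set x := e.symm y with hx
  have hxs : x ∈ e.source := e.map_target hy
  have hex : e x = y := e.right_inv hy
  let φ : M → ℝ := fun z => t * barrierFun (metricInChart e) y₀ κ c (e z)
  have hφ : ContMDiffAt (𝓡 n) 𝓘(ℝ, ℝ) 2 φ x := by
    have h1 : ContDiffAt ℝ ∞ (fun z => t * barrierFun (metricInChart e) y₀ κ c z) (e x) := by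
      rw [hex]
      exact contDiffAt_const.mul (contDiffAt_barrierFun hc hρ)
    have h2 : ContMDiffAt (𝓡 n) (𝓡 n) ∞ e x := contMDiffAt_of_mem_maximalAtlas he hxs
    exact (h1.contMDiffAt.comp x h2).of_le ENat.LEInfty.out
  have hφx : φ x = u x := by
    simp only [φ, hex, heq]
  have hφle : ∀ᶠ z in 𝓝 x, u z ≤ φ z := by
    have h1 : Filter.Tendsto e (𝓝 x) (𝓝 y) := by
      have := e.continuousAt hxs
      rwa [ContinuousAt, hex] at this
    filter_upwards [h1.eventually hle, e.open_source.mem_nhds hxs] with z hz hzs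
    rwa [e.left_inv hzs] at hz
  obtain ⟨lam, hspec, hlam⟩ := hvisc x hyD φ hφ hφx hφle
  have hlam' := hspec e he hxs
  rw [hex] at hlam'
  -- The constant multiple t adds a constant to the conformal exponent, since φ^(4/(n-2)) = e^(2X)
  -- when φ = e^((n-2)X/2).
  refine hlam (hcone (2 / ((n : ℝ) - 2) * Real.log t) _ ?_ lam hlam')
  filter_upwards [e.open_target.mem_nhds hy] with z hz
  have : φ (e.symm z) = Real.exp (((n : ℝ) - 2) / 2
      * (barrierExp κ c (frozenSq (metricInChart e) y₀ z) + 2 / ((n : ℝ) - 2) * Real.log t)) := by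
    simp only [φ, e.right_inv hz, barrierFun]
    nth_rewrite 1 [← Real.exp_log ht]
    rw [← Real.exp_add]
    congr 1
    field_simp
    ring
  unfold conformalMetricInChart
  rw [this, ← Real.exp_mul]
  congr 2
  field_simp
  ring

end Main

end

theorem theorem3p1 {n : ℕ} (hn : 3 ≤ n)
    {M : Type*} [MetricSpace M] [ConnectedSpace M] [CompleteSpace M]
    [ChartedSpace (EuclideanSpace ℝ (Fin n)) M] [IsManifold (𝓡 n) ∞ M]
    [RiemannianBundle (fun x : M => TangentSpace (𝓡 n) x)]
    [IsContMDiffRiemannianBundle (𝓡 n) ∞ (EuclideanSpace ℝ (Fin n))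
      (fun x : M => TangentSpace (𝓡 n) x)]
    [IsRiemannianManifold (𝓡 n) M]
    (Γ : Set (Fin n → ℝ)) (hΓ : IsAdmissibleCone Γ) (hμ : 1 < muPlus Γ)
    (Ω : Set M) (hΩ : IsOpen Ω) (p₀ : M) (hp₀ : p₀ ∈ Ω)
    (u : M → ℝ)
    (hpos : ∀ x ∈ Ω \ {p₀}, 0 < u x)
    (husc : UpperSemicontinuousOn u (Ω \ {p₀}))
    (hbdd : ∀ x ∈ Ω \ {p₀}, ∃ C : ℝ, ∀ᶠ y in 𝓝 x, |u y| ≤ C)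
    (hvisc : IsViscositySolution Γ u (Ω \ {p₀}))
    (hlim : Filter.Tendsto (fun x => u x * dist x p₀ ^ (n - 2)) (𝓝[≠] p₀) (𝓝 0)) :
    ∃ C : ℝ, ∀ᶠ x in 𝓝[≠] p₀, |u x| ≤ C := by
  have hn' : (0 : ℝ) < (n : ℝ) - 2 := by
    have : (3 : ℝ) ≤ n := by exact_mod_cast hn
    linarith
  obtain ⟨L, hL, hdist⟩ := eventually_norm_chartAt_sub_le (n := n) p₀
  set e := chartAt (EuclideanSpace ℝ (Fin n)) p₀ with hedef
  have he : e ∈ IsManifold.maximalAtlas (𝓡 n) ∞ M := IsManifold.chart_mem_maximalAtlas p₀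
  have hps : p₀ ∈ e.source := mem_chart_source _ p₀
  clear_value e
  set y₀ := e p₀ with hy₀def
  have hy₀ : y₀ ∈ e.target := e.map_source hps
  have hey₀ : e.symm y₀ = p₀ := e.left_inv hps
  have hmet := isSmoothMetricOn_metricInChart he
  set G := metricInChart e with hG
  obtain ⟨κ, hκ, m, hm, hmz, hcone⟩ := exists_barrier_mem_cone hn hΓ hμ hmet
    (fun v hv => metricInChart_pos he hy₀ hv) hy₀
  have htend : Filter.Tendsto e.symm (𝓝 y₀) (𝓝 p₀) := by
    have := e.symm.continuousAt (x := y₀) hy₀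
    rwa [ContinuousAt, hey₀] at this
  obtain ⟨R, hR, hball⟩ := Metric.nhds_basis_closedBall.mem_iff.1
    (((hcone.and (e.open_target.mem_nhds hy₀)).and
      ((htend.eventually (hΩ.mem_nhds hp₀)).and (htend.eventually hdist))))
  have hball : ∀ y ∈ Metric.closedBall y₀ R, (_ ∧ y ∈ e.target) ∧ (e.symm y ∈ Ω ∧
      ‖e (e.symm y) - y₀‖ ≤ L * dist (e.symm y) p₀) := fun y hy => hball hy
  have hρpos : ∀ y, y ≠ y₀ → 0 < frozenSq G y₀ y := fun y hy => lt_of_lt_of_le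
    (mul_pos hm (pow_pos (norm_pos_iff.2 (sub_ne_zero.2 hy)) 2)) (hmz y)
  have hmaps : Set.MapsTo e.symm (Metric.closedBall y₀ R \ {y₀}) (Ω \ {p₀}) := by
    intro y hy
    refine ⟨(hball y hy.1).2.1, fun h => hy.2 ?_⟩
    have := congrArg e (Set.mem_singleton_iff.1 h)
    rwa [e.right_inv (hball y hy.1).1.2] at this
  set w : EuclideanSpace ℝ (Fin n) → ℝ := fun y => u (e.symm y) with hw
  have hwusc : UpperSemicontinuousOn w (Metric.closedBall y₀ R \ {y₀}) := by
    intro y hy b hb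
    have h1 := husc (e.symm y) (hmaps hy) b hb
    have h2 : Filter.Tendsto e.symm (𝓝[Metric.closedBall y₀ R \ {y₀}] y)
        (𝓝[Ω \ {p₀}] (e.symm y)) :=
      ((e.symm.continuousAt (x := y) (hball y hy.1).1.2).continuousWithinAt).tendsto_nhdsWithin
        hmaps
    exact h2.eventually h1
  have hcontρ : Continuous (frozenSq G y₀) := contDiff_frozenSq.continuous
  obtain ⟨Q, hQ⟩ := ((isCompact_closedBall y₀ R).image
    (hcontρ.sqrt)).bddAbove
  have hQ : ∀ y ∈ Metric.closedBall y₀ R, √(frozenSq G y₀ y) ≤ Q := fun y hy =>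
    hQ (Set.mem_image_of_mem _ hy)
  have hsph : Metric.sphere y₀ R ⊆ Metric.closedBall y₀ R \ {y₀} := fun y hy =>
    ⟨Metric.sphere_subset_closedBall hy, fun h => by
      rw [Set.mem_singleton_iff.1 h, Metric.mem_sphere, dist_self] at hy
      exact hR.ne hy⟩
  obtain ⟨B, hB⟩ := (hwusc.mono hsph).bddAbove_of_isCompact (isCompact_sphere y₀ R)
  have hB : ∀ y ∈ Metric.sphere y₀ R, w y ≤ B := fun y hy => hB (Set.mem_image_of_mem _ hy)
  obtain ⟨K, hK0, hK⟩ := exists_frozenSq_le G y₀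
  set β : ℝ := Real.exp (((n : ℝ) - 2) / 2 * (-Q)) with hβ
  have hβ0 : 0 < β := Real.exp_pos _
  -- β bounds every barrier from below on the sphere, whatever c is; hence A does not depend on c.
  set A : ℝ := max 1 (B / β) with hA
  have hA1 : 0 < A := lt_of_lt_of_le one_pos (le_max_left _ _)
  have hcomp : ∀ c : ℝ, 0 < c → c ≤ 1 → ∀ y ∈ Metric.closedBall y₀ R, y ≠ y₀ →
      w y ≤ A * barrierFun G y₀ κ c y := by
    intro c hc hc1
    refine le_mul_of_forall_not_touching hwusc ?_ (fun y _ => Real.exp_pos _) ?_ ?_ ?_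
    · exact fun y hy => (contDiffAt_barrierFun hc (hρpos y hy.2)).continuousAt.continuousWithinAt
    · intro y hy
      have hyc := Metric.sphere_subset_closedBall hy
      have h1 : β ≤ barrierFun G y₀ κ c y := by
        refine Real.exp_le_exp.2 ?_
        have := neg_sqrt_le_barrierExp (κ := κ) (c := c) (ρ := frozenSq G y₀ y) hκ hc.le
          ((by positivity : 0 ≤ m * ‖y - y₀‖ ^ 2).trans (hmz y))
        have := hQ y hyc
        gcongr
        linarith
      have h2 : B ≤ A * β := by
        rw [← div_le_iff₀ hβ0]
        exact le_max_right _ _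
      calc w y ≤ B := hB y hy
        _ ≤ A * β := h2
        _ ≤ A * barrierFun G y₀ κ c y := by gcongr
    · have htend' : Filter.Tendsto e.symm (𝓝[≠] y₀) (𝓝[≠] p₀) := by
        refine tendsto_nhdsWithin_of_tendsto_nhds_of_eventually_within _
          (htend.mono_left nhdsWithin_le_nhds) ?_
        filter_upwards [self_mem_nhdsWithin,
          mem_nhdsWithin_of_mem_nhds (Metric.closedBall_mem_nhds y₀ hR)] with y hy hyR
        exact (hmaps ⟨hyR, hy⟩).2
      -- For fixed c the barrier is at least a positive constant times d^(2-n) near the centre; the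
      -- decay hypothesis puts `u` below A times that bound.
      have hsm := (hlim.comp htend').eventually (gt_mem_nhds (mul_pos hA1
        (Real.exp_pos (((n : ℝ) - 2) / 2 * (1 / κ * Real.log c - Real.log (K * L ^ 2) - Q)))))
      filter_upwards [hsm, self_mem_nhdsWithin,
        mem_nhdsWithin_of_mem_nhds (Metric.closedBall_mem_nhds y₀ hR)] with y hy hyne hyR
      have hd : 0 < dist (e.symm y) p₀ := dist_pos.2 (hmaps ⟨hyR, hyne⟩).2
      have hρK : frozenSq G y₀ y ≤ K * L ^ 2 * dist (e.symm y) p₀ ^ 2 := by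
        have h1 := (hball y hyR).2.2
        rw [e.right_inv (hball y hyR).1.2] at h1
        calc frozenSq G y₀ y ≤ K * ‖y - y₀‖ ^ 2 := hK y
          _ ≤ K * (L * dist (e.symm y) p₀) ^ 2 := by gcongr
          _ = _ := by ring
      have h2 := le_barrierFun (by omega) hκ hc (hρpos y hyne) (by positivity) hd hρK (hQ y hyR)
      simp only [Function.comp_apply] at hy
      have hdp : 0 < dist (e.symm y) p₀ ^ (n - 2) := pow_pos hd _
      rw [← lt_div_iff₀ hdp, div_eq_mul_inv, mul_assoc] at hy
      exact hy.le.trans (mul_le_mul_of_nonneg_left h2 hA1.le)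
    · intro y hy hne t ht heq
      have hyc := Metric.ball_subset_closedBall hy
      exact not_eventually_le_barrierFun hn hvisc he hc (hA1.trans ht) (hball y hyc).1.2
        (hmaps ⟨hyc, hne⟩) (hρpos y hne) ((hball y hyc).1.1 hne c hc hc1) heq
  refine ⟨A * Real.exp (((n : ℝ) - 2) / 2 * ((1 / κ) * Real.log 2)), ?_⟩
  rw [eventually_nhdsWithin_iff]
  have hcont : Filter.Tendsto e (𝓝 p₀) (𝓝 y₀) := e.continuousAt hps
  filter_upwards [hcont.eventually (Metric.closedBall_mem_nhds y₀ hR),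
    e.open_source.mem_nhds hps, hΩ.mem_nhds hp₀] with x hxR hxs hxΩ hxne
  have hyne : e x ≠ y₀ := fun h => hxne (e.injOn hxs hps h)
  have hρ := hρpos _ hyne
  rw [abs_of_pos (hpos x ⟨hxΩ, hxne⟩)]
  -- Instead of letting c tend to 0, c is adapted to the point: c ≤ ρ^κ makes c ρ^(-κ) ≤ 1, so the
  -- exponent is at most (1/κ) log 2.
  have hc0 : 0 < min 1 ((frozenSq G y₀ (e x)) ^ κ) := lt_min one_pos (by positivity)
  have h1 := hcomp _ hc0 (min_le_left _ _) (e x) hxR hyne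
  simp only [hw, e.left_inv hxs] at h1
  refine h1.trans ?_
  unfold barrierFun
  gcongr
  exact barrierExp_le hκ hc0.le hρ (min_le_right _ _)
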